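/- Let $A$ be a regular local Noetherian ring with maximal ideal $I$, let $L_0$ be the zeroth left derived functor of the $I$-adic completion functor $M\mapsto\lim_n M/I^nM$ on $A$-modules, and call an $A$-module $M$ $L$-complete if the natural map $\eta\colon M\to L_0M$ is an isomorphism; let $\iota_A\colon\widehat{\mathrm{Mod}}\hookrightarrow\mathrm{Mod}_A$ be the inclusion of the full subcategory of $L$-complete modules. (Restriction along $A\to\widehat A=L_0A$ identifies the $L$-complete $\widehat A$-modules with the $L$-complete $A$-modules.) Let $(A,\Psi)$ be a Hopf algebroid, i.e. a cogroupoid object in commutative rings, with left and right units $\eta_L,\eta_R\colon A\to\Psi$, such that $\Psi$ is flat over $A$ (via $\eta_L$) and $I$ is invariant: $\eta_L(I)\Psi=\eta_R(I)\Psi$. Let $\mathrm{Comod}_\Psi$ be the category of left $\Psi$-comodules, and let $\epsilon^*\colon\mathrm{Mod}_A\to\mathrm{Comod}_\Psi$, $N\mapsto\Psi\otimes_AN$, be the extended comodule functor, right adjoint to the forgetful functor. For an $A$-bimodule $X$ and an $A$-module $M$ write $X\boxtimes M=L_0(X\otimes_AM)$, and put $\widehat\Psi=L_0\Psi$ with the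 induced comultiplication $\widehat\Delta\colon\widehat\Psi\to\widehat\Psi\boxtimes\widehat\Psi$ and counit $\widehat\Psi\to\widehat A$. An $L$-complete $\widehat\Psi$-comodule is an $L$-complete module $N$ with a counital and coassociative map $N\to\widehat\Psi\boxtimes N$; these form the category $\widehat{\mathrm{Comod}}_{\widehat\Psi}$. For every $A$-module $N$, the module $\widehat\Psi\boxtimes N$ is an (extended) $L$-complete $\widehat\Psi$-comodule with coaction $\widehat\Delta\boxtimes1$; for $L$-complete $N$ this is the right adjoint $\widehat\epsilon^*$ of the forgetful functor $\widehat{\mathrm{Comod}}_{\widehat\Psi}\to\widehat{\mathrm{Mod}}$. For a $\Psi$-comodule $(M,\psi_M)$, the module $L_0M$ is an $L$-complete $\widehat\Psi$-comodule with coaction $L_0M\xrightarrow{L_0(\psi_M)}L_0(\Psi\otimes_AM)\to\widehat\Psi\boxtimes L_0M$; this defines a functor $L_0\colon\mathrm{Comod}_\Psi\to\widehat{\mathrm{Comod}}_{\widehat\Psi}$. Proposition. The functor $L_0\colon\mathrm{Comod}_\Psi\to\widehat{\mathrm{Comod}}_{\widehat\Psi}$ has a right adjoint. Let $\iota\colon\widehat{\mathrm{Comod}}_{\widehat\Psi}\to\mathrm{Comod}_\Psi$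 be any right adjoint of it. Then for every $A$-module $N$ there is an isomorphism of $\Psi$-comodules $$\iota(\widehat\Psi\boxtimes N)\cong\Psi\otimes_AL_0N,$$ where both sides carry the extended comodule structures, and these isomorphisms can be chosen natural in $N$. Moreover, there is a natural isomorphism of functors $\iota\circ\widehat\epsilon^*\cong\epsilon^*\circ\iota_A$ from $L$-complete modules to $\Psi$-comodules. -/

import Mathlib

open CategoryTheory CategoryTheory.Limits TensorProduct

universe u

namespace LComp

noncomputable section

section Derived

variable {C D : Type*} [Category C] [Category D] [Abelian C] [Abelian D]

lemma fromLDZ'_nat {X : C} (P : ProjectiveResolution X) {F G : C ⥤ D} [F.Additive] [G.Additive]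
    (α : F ⟶ G) :
    HomologicalComplex.opcyclesMap ((NatTrans.mapHomologicalComplex α _).app P.complex) 0 ≫
      P.fromLeftDerivedZero' G = P.fromLeftDerivedZero' F ≫ α.app X := by
  rw [← cancel_epi (HomologicalComplex.pOpcycles _ _),
    HomologicalComplex.p_opcyclesMap_assoc,
    ProjectiveResolution.pOpcycles_comp_fromLeftDerivedZero',
    ProjectiveResolution.pOpcycles_comp_fromLeftDerivedZero'_assoc]
  exact (α.naturality _).symm

def h0 (K : ChainComplex D ℕ) :
    (HomologicalComplex.homologyFunctor D (ComplexShape.down ℕ) 0).obj K ≅ K.opcycles 0 :=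
  ChainComplex.isoHomologyι₀ K

lemma h0_nat {K L : ChainComplex D ℕ} (φ : K ⟶ L) :
    (HomologicalComplex.homologyFunctor D (ComplexShape.down ℕ) 0).map φ ≫ (h0 L).hom =
    (h0 K).hom ≫ HomologicalComplex.opcyclesMap φ 0 :=
  (HomologicalComplex.homologyι_naturality φ 0)

lemma h0_inv_nat {K L : ChainComplex D ℕ} (φ : K ⟶ L) :
    (h0 K).inv ≫ (HomologicalComplex.homologyFunctor D (ComplexShape.down ℕ) 0).map φ =
    HomologicalComplex.opcyclesMap φ 0 ≫ (h0 L).inv := by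
  rw [Iso.inv_comp_eq, ← Category.assoc, ← h0_nat, Category.assoc, Iso.hom_inv_id, Category.comp_id]

/-- The augmentation of a resolution in degree zero. -/
def p0 {M : C} (P : ProjectiveResolution M) : P.complex.X 0 ⟶ M := P.π.f 0

lemma p0_epi {M : C} (P : ProjectiveResolution M) : Epi (p0 P) :=
  inferInstanceAs (Epi (P.π.f 0))

variable (F : C ⥤ D) [F.Additive]

def pO {M : C} (P : ProjectiveResolution M) :
    F.obj (P.complex.X 0) ⟶ HomologicalComplex.opcycles ((F.mapHomologicalComplex _).obj P.complex) 0 :=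
  HomologicalComplex.pOpcycles ((F.mapHomologicalComplex _).obj P.complex) 0

instance pO_epi {M : C} (P : ProjectiveResolution M) : Epi (pO F P) :=
  inferInstanceAs (Epi (HomologicalComplex.pOpcycles ((F.mapHomologicalComplex _).obj P.complex) 0))

lemma d_pO {M : C} (P : ProjectiveResolution M) : F.map (P.complex.d 1 0) ≫ pO F P = 0 :=
  HomologicalComplex.d_pOpcycles ((F.mapHomologicalComplex _).obj P.complex) 1 0

lemma pO_exact {M : C} (P : ProjectiveResolution M) :
    (ShortComplex.mk _ _ (d_pO F P)).Exact :=
  ShortComplex.exact_of_g_is_cokernel (ShortComplex.mk _ _ (d_pO F P))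
      (HomologicalComplex.opcyclesIsCokernel ((F.mapHomologicalComplex _).obj P.complex) 1 0 (by simp))

lemma pO_nat {M N : C} (P : ProjectiveResolution M) (Q : ProjectiveResolution N)
    (φ : P.complex ⟶ Q.complex) :
    pO F P ≫ HomologicalComplex.opcyclesMap ((F.mapHomologicalComplex _).map φ) 0 =
      F.map (φ.f 0) ≫ pO F Q :=
  HomologicalComplex.p_opcyclesMap ((F.mapHomologicalComplex _).map φ) 0

lemma pO_from {M : C} (P : ProjectiveResolution M) :
    pO F P ≫ P.fromLeftDerivedZero' F = F.map (P.π.f 0) :=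
  ProjectiveResolution.pOpcycles_comp_fromLeftDerivedZero' P F

variable [HasProjectiveResolutions C]

lemma from_eq {M : C} (P : ProjectiveResolution M) :
    F.fromLeftDerivedZero.app M =
      (P.isoLeftDerivedObj F 0).hom ≫ (h0 _).hom ≫ P.fromLeftDerivedZero' F :=
  P.fromLeftDerivedZero_eq F

def cP {M : C} (P : ProjectiveResolution M) :
    F.obj (P.complex.X 0) ⟶ (F.leftDerived 0).obj M :=
  pO F P ≫ (h0 _).inv ≫ (P.isoLeftDerivedObj F 0).inv

instance cP_epi {M : C} (P : ProjectiveResolution M) : Epi (cP F P) := by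
  unfold cP
  infer_instance

lemma d_cP {M : C} (P : ProjectiveResolution M) : F.map (P.complex.d 1 0) ≫ cP F P = 0 := by
  unfold cP
  rw [← Category.assoc, d_pO, zero_comp]

lemma cP_exact {M : C} (P : ProjectiveResolution M) :
    (ShortComplex.mk _ _ (d_cP F P)).Exact := by
  refine (ShortComplex.exact_iff_of_iso (S₁ := ShortComplex.mk _ _ (d_pO F P))
    (S₂ := ShortComplex.mk _ _ (d_cP F P)) (ShortComplex.isoMk (Iso.refl _) (Iso.refl _)
    ((h0 ((F.mapHomologicalComplex _).obj P.complex)).symm ≪≫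
      (P.isoLeftDerivedObj F 0).symm) ?_ ?_)).1 (pO_exact F P)
  · simp
  · simp [cP]

lemma cP_nat {M N : C} (P : ProjectiveResolution M) (Q : ProjectiveResolution N)
    (f : M ⟶ N) (φ : P.complex ⟶ Q.complex) (h : φ.f 0 ≫ Q.π.f 0 = P.π.f 0 ≫ f) :
    cP F P ≫ (F.leftDerived 0).map f = F.map (φ.f 0) ≫ cP F Q := by
  unfold cP
  simp only [Category.assoc]
  rw [ProjectiveResolution.isoLeftDerivedObj_inv_naturality f P Q φ h]
  rw [← Category.assoc (F.map _), ← pO_nat, Category.assoc, ← reassoc_of% h0_inv_nat]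
  rfl

lemma cP_from {M : C} (P : ProjectiveResolution M) :
    cP F P ≫ F.fromLeftDerivedZero.app M = F.map (P.π.f 0) := by
  unfold cP
  rw [from_eq F P]
  simp only [Category.assoc, Iso.inv_hom_id_assoc]
  rw [pO_from]

lemma leftDerived_zero_map_add {M N : C} (f g : M ⟶ N) :
    (F.leftDerived 0).map (f + g) = (F.leftDerived 0).map f + (F.leftDerived 0).map g := by
  have P := projectiveResolution M
  have Q := projectiveResolution N
  rw [← cancel_epi (cP F P), Preadditive.comp_add]
  have hf := ProjectiveResolution.lift_commutes_zero f P Q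
  have hg := ProjectiveResolution.lift_commutes_zero g P Q
  have h : (ProjectiveResolution.lift f P Q + ProjectiveResolution.lift g P Q).f 0 ≫ Q.π.f 0 =
      P.π.f 0 ≫ (f + g) := by
    rw [HomologicalComplex.add_f_apply, Preadditive.add_comp]
    exact (congrArg₂ (· + ·) hf hg).trans (Preadditive.comp_add _ _ _ (P.π.f 0) f g).symm
  rw [cP_nat F P Q f _ hf, cP_nat F P Q g _ hg, cP_nat F P Q (f + g) _ h,
    HomologicalComplex.add_f_apply, F.map_add, Preadditive.add_comp]

lemma leftDerived_from (G : C ⥤ D) [G.Additive] (α : F ⟶ G) (M : C) :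
    (NatTrans.leftDerived α 0).app M ≫ G.fromLeftDerivedZero.app M =
      F.fromLeftDerivedZero.app M ≫ α.app M := by
  have P := projectiveResolution M
  rw [from_eq G P, from_eq F P, P.leftDerived_app_eq]
  simp only [Category.assoc, Iso.inv_hom_id_assoc]
  rw [← fromLDZ'_nat]
  rw [reassoc_of% h0_nat]

/-- The canonical map `F P ⟶ (L₀F) P`, for `P` projective. -/
def tt (P : C) [Projective P] : F.obj P ⟶ (F.leftDerived 0).obj P :=
  cP F (ProjectiveResolution.self P)

lemma tt_from (P : C) [Projective P] : tt F P ≫ F.fromLeftDerivedZero.app P = 𝟙 _ :=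
  (cP_from F (ProjectiveResolution.self P)).trans (F.map_id _)

lemma from_isIso (P : C) [Projective P] : IsIso (F.fromLeftDerivedZero.app P) := by
  rw [from_eq F (ProjectiveResolution.self P)]
  infer_instance

lemma from_tt (P : C) [Projective P] : F.fromLeftDerivedZero.app P ≫ tt F P = 𝟙 _ := by
  have := from_isIso F P
  rw [← cancel_mono (F.fromLeftDerivedZero.app P), Category.assoc, tt_from]
  simp

lemma tt_nat {P Q : C} [Projective P] [Projective Q] (f : P ⟶ Q) :
    tt F P ≫ (F.leftDerived 0).map f = F.map f ≫ tt F Q := by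
  have := from_isIso F Q
  rw [← cancel_mono (F.fromLeftDerivedZero.app Q), Category.assoc, NatTrans.naturality,
    Category.assoc, tt_from, ← Category.assoc, tt_from]
  simp

lemma tt_nat_assoc {P Q : C} [Projective P] [Projective Q] (f : P ⟶ Q) {Z : D}
    (h : (F.leftDerived 0).obj Q ⟶ Z) :
    tt F P ≫ (F.leftDerived 0).map f ≫ h = F.map f ≫ tt F Q ≫ h := by
  rw [← Category.assoc, tt_nat, Category.assoc]

lemma tt_cP {M : C} (P : ProjectiveResolution M) :
    have : Projective (P.complex.X 0) := P.projective 0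
    tt F (P.complex.X 0) ≫ (F.leftDerived 0).map (p0 P) = cP F P := by
  intro _
  let φ : (ProjectiveResolution.self (P.complex.X 0)).complex ⟶ P.complex :=
    (ChainComplex.fromSingle₀Equiv _ _).symm (𝟙 _)
  have hφ : φ.f 0 = 𝟙 (P.complex.X 0) := by
    exact ChainComplex.fromSingle₀Equiv_symm_apply_f_zero _
  have h := cP_nat F (ProjectiveResolution.self (P.complex.X 0)) P (P.π.f 0) φ (by
    rw [hφ]; rfl)
  exact h.trans ((congrArg (· ≫ cP F P) ((congrArg F.map hφ).trans (F.map_id _))).trans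
    (Category.id_comp _))

lemma leftDerived_map_zero (M N : C) : (F.leftDerived 0).map (0 : M ⟶ N) = 0 := by
  have := leftDerived_zero_map_add F (0 : M ⟶ N) 0
  simpa using this

lemma leftDerived_epi {M N : C} (f : M ⟶ N) [Epi f] : Epi ((F.leftDerived 0).map f) := by
  have P := projectiveResolution N
  have : Projective (P.complex.X 0) := P.projective 0
  have h := tt_cP F P
  have e := cP_epi F P
  have hpi : Epi (p0 P) := p0_epi P
  have hb : Projective.factorThru (p0 P) f ≫ f = p0 P := Projective.factorThru_comp _ _
  rw [← h] at e
  have e2 := @epi_of_epi _ _ _ _ _ _ _ e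
  have h3 : (F.leftDerived 0).map (Projective.factorThru (p0 P) f) ≫ (F.leftDerived 0).map f
    = (F.leftDerived 0).map (p0 P) := by rw [← Functor.map_comp]; exact congrArg _ hb
  rw [← h3] at e2
  exact @epi_of_epi _ _ _ _ _ _ _ e2

end Derived

section Modules

variable {A : Type u} [CommRing A] (I : Ideal A)

/-- The `I`-adic completion functor `M ↦ lim M / Iⁿ M` on `A`-modules. -/
def adic : ModuleCat.{u} A ⥤ ModuleCat.{u} A where
  obj M := ModuleCat.of A (AdicCompletion I M)
  map f := ModuleCat.ofHom ((AdicCompletion.map I f.hom).restrictScalars A)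
  map_id M := by
    ext x
    simp [AdicCompletion.map_id]
  map_comp f g := by
    ext x
    simp

instance : (adic I).Additive where
  map_add {M N f g} := by
    refine ModuleCat.hom_ext (LinearMap.ext fun x => ?_)
    induction x using AdicCompletion.induction_on with
    | _ a =>
      refine AdicCompletion.ext fun n => ?_
      rfl

/-- The natural map from a module to its adic completion. -/
def adicOf : 𝟭 (ModuleCat.{u} A) ⟶ adic I where
  app M := ModuleCat.ofHom (AdicCompletion.of I M)
  naturality M N f := by
    ext x
    exact (AdicCompletion.map_of I f.hom x).symm

/-- `L₀`, the zeroth left derived functor of `I`-adic completion. -/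
abbrev L0 : ModuleCat.{u} A ⥤ ModuleCat.{u} A := (adic I).leftDerived 0

/-- The natural map `η : M ⟶ L₀ M`, induced by `M ⟶ lim M / Iⁿ M` on zeroth derived functors. -/
def eta : 𝟭 (ModuleCat.{u} A) ⟶ L0 I :=
  (𝟭 (ModuleCat.{u} A)).leftDerivedZeroIsoSelf.inv ≫ NatTrans.leftDerived (adicOf I) 0

/-- A module `M` is `L`-complete if `η : M ⟶ L₀ M` is an isomorphism. -/
def IsLComplete : ObjectProperty (ModuleCat.{u} A) := fun M => IsIso ((eta I).app M)

/-- The canonical map `L₀ M ⟶ lim M / Iⁿ M`. -/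
abbrev theta : L0 I ⟶ adic I := (adic I).fromLeftDerivedZero

lemma eta_theta (M : ModuleCat.{u} A) : (eta I).app M ≫ (theta I).app M = (adicOf I).app M := by
  rw [eta, NatTrans.comp_app, Category.assoc, theta, leftDerived_from]
  erw [Functor.leftDerivedZeroIsoSelf_inv_hom_id_app_assoc]

lemma adic_map_surj {M N : ModuleCat.{u} A} (f : M ⟶ N) [Epi f] :
    Function.Surjective ((adic I).map f) :=
  AdicCompletion.map_surjective I ((ModuleCat.epi_iff_surjective f).1 inferInstance)

lemma L0_surj {M N : ModuleCat.{u} A} (f : M ⟶ N) [Epi f] :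
    Function.Surjective ((L0 I).map f) :=
  (ModuleCat.epi_iff_surjective _).1 (leftDerived_epi _ f)

/-- Covering `L₀ M` by the completion of a projective cover of `M`. -/
lemma L0_cover {F M : ModuleCat.{u} A} [Projective F] (f : F ⟶ M) [Epi f] :
    Function.Surjective (tt (adic I) F ≫ (L0 I).map f) := by
  intro y
  obtain ⟨x, rfl⟩ := L0_surj I f y
  refine ⟨(theta I).app F x, ?_⟩
  have := ConcreteCategory.congr_hom (from_tt (adic I) F) x
  exact congrArg ((L0 I).map f) this

lemma L0_cover_ker {F M : ModuleCat.{u} A} [Projective F] (f : F ⟶ M) [Epi f]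
    (x : (adic I).obj F) (hx : (L0 I).map f (tt (adic I) F x) = 0) :
    ∃ y, (adic I).map (kernel.ι f) y = x := by
  have P := projectiveResolution M
  have : Projective (P.complex.X 0) := P.projective 0
  have := p0_epi P
  let a : F ⟶ P.complex.X 0 := Projective.factorThru f (p0 P)
  have ha : a ≫ p0 P = f := Projective.factorThru_comp _ _
  let b : P.complex.X 0 ⟶ F := Projective.factorThru (p0 P) f
  have hb : b ≫ f = p0 P := Projective.factorThru_comp _ _
  have h1 : tt (adic I) F ≫ (L0 I).map f = (adic I).map a ≫ cP (adic I) P := by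
    rw [← ha, Functor.map_comp, ← Category.assoc, tt_nat, Category.assoc, tt_cP]
  have h2 : cP (adic I) P ((adic I).map a x) = 0 :=
    (ConcreteCategory.congr_hom h1 x).symm.trans hx
  obtain ⟨y, hy⟩ := (ShortComplex.moduleCat_exact_iff _).1 (cP_exact (adic I) P) _ h2
  have hy : (adic I).map (P.complex.d 1 0) y = (adic I).map a x := hy
  have hd : (P.complex.d 1 0 ≫ b) ≫ f = 0 := by
    rw [Category.assoc, hb]
    exact P.complex_d_comp_π_f_zero
  have hab : (𝟙 F - a ≫ b) ≫ f = 0 := by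
    rw [Preadditive.sub_comp, Category.assoc, hb, ha, Category.id_comp, sub_self]
  refine ⟨(adic I).map (kernel.lift f _ hd) y + (adic I).map (kernel.lift f _ hab) x, ?_⟩
  rw [map_add]
  have e1 : (adic I).map (kernel.ι f) ((adic I).map (kernel.lift f _ hd) y) =
      (adic I).map b ((adic I).map (P.complex.d 1 0) y) := by
    rw [← ModuleCat.comp_apply, ← ModuleCat.comp_apply, ← Functor.map_comp, ← Functor.map_comp,
      kernel.lift_ι]
  have e2 : (adic I).map (kernel.ι f) ((adic I).map (kernel.lift f _ hab) x) =
      x - (adic I).map b ((adic I).map a x) := by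
    rw [← ModuleCat.comp_apply, ← ModuleCat.comp_apply, ← Functor.map_comp, ← Functor.map_comp,
      kernel.lift_ι, Functor.map_sub, CategoryTheory.Functor.map_id]
    rfl
  rw [e1, e2, hy]
  abel

/-- Right exactness of `L₀`. -/
lemma L0_exact {W X Y : ModuleCat.{u} A} (h : W ⟶ X) (g : X ⟶ Y) [Epi g] (w : h ≫ g = 0)
    (hS : (ShortComplex.mk h g w).Exact) (x : (L0 I).obj X) (hx : (L0 I).map g x = 0) :
    ∃ v, (L0 I).map h v = x := by
  let F := Projective.over X
  let π : F ⟶ X := Projective.π X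
  obtain ⟨p, rfl⟩ := L0_cover I π x
  have hx' : (L0 I).map (π ≫ g) (tt (adic I) F p) = 0 := by
    rw [Functor.map_comp]; exact hx
  have := epi_comp π g
  obtain ⟨r, rfl⟩ := L0_cover_ker I (π ≫ g) p hx'
  let E := Projective.over (kernel (π ≫ g))
  let e : E ⟶ _ := Projective.π (kernel (π ≫ g))
  obtain ⟨r, rfl⟩ := adic_map_surj I e r
  have hs0 : (e ≫ kernel.ι (π ≫ g) ≫ π) ≫ g = 0 := by
    simp only [Category.assoc, kernel.condition, comp_zero]
  let s := hS.liftFromProjective (e ≫ kernel.ι (π ≫ g) ≫ π) hs0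
  have hs : s ≫ h = e ≫ kernel.ι (π ≫ g) ≫ π := hS.liftFromProjective_comp _ hs0
  refine ⟨(L0 I).map s (tt (adic I) E r), ?_⟩
  have key : tt (adic I) E ≫ (L0 I).map s ≫ (L0 I).map h =
      (adic I).map e ≫ (adic I).map (kernel.ι (π ≫ g)) ≫ tt (adic I) F ≫ (L0 I).map π := by
    rw [← Functor.map_comp, hs, ← Category.assoc, Functor.map_comp, tt_nat_assoc,
      Functor.map_comp_assoc]
  exact ConcreteCategory.congr_hom key r

/-- `L₀ Q = 0` if `Q = I Q`. -/
lemma L0_eq_zero {Q : ModuleCat.{u} A} (hQ : (I • ⊤ : Submodule A Q) = ⊤) (y : (L0 I).obj Q) :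
    y = 0 := by
  let F := Projective.over Q
  let f : F ⟶ Q := Projective.π Q
  obtain ⟨x, rfl⟩ := L0_cover I f y
  have hs : Function.Surjective ((adic I).map (kernel.ι f)) := by
    refine AdicCompletion.map_surjective_of_mkQ_comp_surjective fun t => ?_
    obtain ⟨x, rfl⟩ := Submodule.Quotient.mk_surjective _ t
    have hfs : Submodule.map f.hom (⊤ : Submodule A F) = ⊤ :=
      Submodule.map_top f.hom ▸ LinearMap.range_eq_top.2
        ((ModuleCat.epi_iff_surjective f).1 inferInstance)
    have hm : f x ∈ Submodule.map f.hom (I • ⊤ : Submodule A F) := by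
      rw [Submodule.map_smul'', hfs, hQ]; trivial
    obtain ⟨t, ht, htx⟩ := hm
    have hk : f.hom (x - t) = 0 := by rw [map_sub, htx]; exact sub_self _
    let k : ModuleCat.of A (LinearMap.ker f.hom) ⟶ F :=
      ModuleCat.ofHom (LinearMap.ker f.hom).subtype
    have hkf : k ≫ f = 0 := by
      ext z
      exact z.2
    refine ⟨kernel.lift f k hkf ⟨x - t, hk⟩, ?_⟩
    have : kernel.ι f (kernel.lift f k hkf ⟨x - t, hk⟩) = x - t :=
      ConcreteCategory.congr_hom (kernel.lift_ι f k hkf) ⟨x - t, hk⟩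
    change Submodule.Quotient.mk (kernel.ι f (kernel.lift f k hkf ⟨x - t, hk⟩)) = _
    rw [this, Submodule.Quotient.eq]
    simpa using ht
  obtain ⟨z, rfl⟩ := hs x
  let e := Projective.π (kernel f)
  obtain ⟨z, rfl⟩ := adic_map_surj I e z
  have key : (adic I).map e ≫ (adic I).map (kernel.ι f) ≫ tt (adic I) F ≫ (L0 I).map f = 0 := by
    rw [← Functor.map_comp_assoc, ← tt_nat_assoc, ← Functor.map_comp]
    simp [leftDerived_map_zero]
  exact ConcreteCategory.congr_hom key z

lemma top_of_epi {M N : ModuleCat.{u} A} (f : M ⟶ N) [Epi f]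
    (h : (I • ⊤ : Submodule A M) = ⊤) : (I • ⊤ : Submodule A N) = ⊤ := by
  have hfs : Submodule.map f.hom (⊤ : Submodule A M) = ⊤ :=
    Submodule.map_top f.hom ▸ LinearMap.range_eq_top.2
      ((ModuleCat.epi_iff_surjective f).1 inferInstance)
  rw [← hfs, ← Submodule.map_smul'', h]

variable [IsNoetherianRing A]

/-- The cokernel of `P ⟶ lim P / Iⁿ P` is `I`-divisible. -/
lemma coker_adicOf (M : ModuleCat.{u} A) :
    (I • ⊤ : Submodule A (cokernel ((adicOf I).app M) : ModuleCat.{u} A)) = ⊤ := by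
  let c := cokernel.π ((adicOf I).app M)
  have hcs : Function.Surjective c := (ModuleCat.epi_iff_surjective c).1 inferInstance
  rw [eq_top_iff]
  intro y _
  obtain ⟨x, rfl⟩ := hcs y
  obtain ⟨m, hm⟩ := Submodule.Quotient.mk_surjective _ (AdicCompletion.eval I M 1 x)
  have hx : x - (adicOf I).app M m ∈ (I • ⊤ : Submodule A (AdicCompletion I M)) := by
    have h1 := AdicCompletion.pow_smul_top_eq_ker_eval (M := M) (n := 1)
      (IsNoetherian.noetherian I)
    have h2 : x - (adicOf I).app M m ∈ (I ^ 1 • ⊤ : Submodule A (AdicCompletion I M)) := by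
      rw [h1]
      refine ((AdicCompletion.eval I M 1).map_sub x (AdicCompletion.of I M m)).trans ?_
      rw [← hm]
      exact sub_self _
    simpa only [pow_one] using h2
  have h0 : c ((adicOf I).app M m) = 0 :=
    ConcreteCategory.congr_hom (cokernel.condition ((adicOf I).app M)) m
  have : c x = c (x - (adicOf I).app M m) := by rw [map_sub, h0, sub_zero]
  rw [this]
  have hmem : c.hom (x - (adicOf I).app M m) ∈ Submodule.map c.hom (I • ⊤) := ⟨_, hx, rfl⟩
  rw [Submodule.map_smul''] at hmem
  exact Submodule.smul_mono le_rfl le_top hmem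

lemma eta_adic_isIso (P : ModuleCat.{u} A) [Projective P] :
    IsIso ((eta I).app ((adic I).obj P)) := by
  have hL : Function.Surjective ((L0 I).map ((adicOf I).app P)) := by
    intro y
    have hS : (ShortComplex.mk _ _ (cokernel.condition ((adicOf I).app P))).Exact :=
      ShortComplex.exact_cokernel _
    exact L0_exact I _ _ _ hS y (L0_eq_zero I (coker_adicOf I P) _)
  have hof : Function.Bijective ((adicOf I).app ((adic I).obj P)) :=
    AdicCompletion.of_bijective_iff.2 (AdicCompletion.isAdicComplete (IsNoetherian.noetherian I))
  have hnat := (theta I).naturality ((adicOf I).app P)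
  have hinj : Function.Injective ((adic I).map ((adicOf I).app P)) := by
    intro x y hxy
    refine AdicCompletion.ext fun n => ?_
    let E := Submodule.liftQ _ (AdicCompletion.eval I P n)
      (AdicCompletion.pow_smul_top_le_ker_eval I n)
    have hE (z : (adic I).obj P) : E (AdicCompletion.eval I (AdicCompletion I P) n
        ((adic I).map ((adicOf I).app P) z)) = AdicCompletion.eval I P n z := by
      induction z using AdicCompletion.induction_on with
      | _ a => rfl
    exact (hE x).symm.trans ((congrArg (fun t => E (AdicCompletion.eval I _ n t)) hxy).trans (hE y))
  have hθ : Function.Injective ((theta I).app ((adic I).obj P)) := by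
    intro y₁ y₂ hy
    obtain ⟨x₁, rfl⟩ := hL y₁
    obtain ⟨x₂, rfl⟩ := hL y₂
    have e₁ := ConcreteCategory.congr_hom hnat x₁
    have e₂ := ConcreteCategory.congr_hom hnat x₂
    have : (theta I).app P x₁ = (theta I).app P x₂ := hinj (e₁.symm.trans (hy.trans e₂))
    have hi := from_isIso (adic I) P
    have := ((ConcreteCategory.isIso_iff_bijective ((theta I).app P)).1 hi).1 this
    rw [this]
  refine (ConcreteCategory.isIso_iff_bijective _).2 ⟨?_, ?_⟩
  · intro a b hab
    refine hof.1 ?_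
    rw [← eta_theta]
    exact congrArg ((theta I).app _) hab
  · intro y
    obtain ⟨a, ha⟩ := hof.2 ((theta I).app _ y)
    refine ⟨a, hθ ?_⟩
    rw [← ha, ← eta_theta]
    rfl

lemma eta_L0_isIso_of_projective (P : ModuleCat.{u} A) [Projective P] :
    IsIso ((eta I).app ((L0 I).obj P)) := by
  have h1 := eta_adic_isIso I P
  have h2 := from_isIso (adic I) P
  have hn := (eta I).naturality ((theta I).app P)
  have : (eta I).app ((L0 I).obj P) =
      (theta I).app P ≫ (eta I).app ((adic I).obj P) ≫ (L0 I).map (inv ((theta I).app P)) := by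
    rw [← Category.assoc]
    erw [hn]
    rw [Category.assoc]
    erw [← Functor.map_comp]
    simp
  rw [this]
  infer_instance

/-- `L₀ M` is `L`-complete. -/
theorem isLComplete_L0 (M : ModuleCat.{u} A) : IsLComplete I ((L0 I).obj M) := by
  let P := Projective.over M
  let π : P ⟶ M := Projective.π M
  let e := Projective.π (kernel π)
  let h := e ≫ kernel.ι π
  have w : h ≫ π = 0 := by simp [h]
  have hS : (ShortComplex.mk h π w).Exact := by
    rw [ShortComplex.moduleCat_exact_iff]
    intro x hx
    obtain ⟨k, rfl⟩ := (ShortComplex.moduleCat_exact_iff _).1 (ShortComplex.exact_kernel π) x hx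
    obtain ⟨k, rfl⟩ := (ModuleCat.epi_iff_surjective e).1 inferInstance k
    exact ⟨k, rfl⟩
  have iQ := (ConcreteCategory.isIso_iff_bijective _).1
    (eta_L0_isIso_of_projective I (Projective.over (kernel π)))
  have iP := (ConcreteCategory.isIso_iff_bijective _).1 (eta_L0_isIso_of_projective I P)
  have nP := (eta I).naturality ((L0 I).map π)
  have nQ := (eta I).naturality ((L0 I).map h)
  have s1 := L0_surj I π
  have := leftDerived_epi (adic I) π
  have s2 := L0_surj I ((L0 I).map π)
  have w' : (L0 I).map h ≫ (L0 I).map π = 0 := by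
    rw [← Functor.map_comp, w, leftDerived_map_zero]
  have hS' : (ShortComplex.mk _ _ w').Exact := by
    rw [ShortComplex.moduleCat_exact_iff]
    intro x hx
    exact L0_exact I h π w hS x hx
  refine (ConcreteCategory.isIso_iff_bijective _).2 ⟨?_, ?_⟩
  · rw [injective_iff_map_eq_zero]
    intro a ha
    obtain ⟨b, rfl⟩ := s1 a
    have hb : (L0 I).map ((L0 I).map π) ((eta I).app _ b) = 0 :=
      (ConcreteCategory.congr_hom nP b).symm.trans ha
    obtain ⟨c, hc⟩ := L0_exact I _ _ w' hS' _ hb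
    obtain ⟨d, rfl⟩ := iQ.2 c
    have e1 := (ConcreteCategory.congr_hom nQ d).trans hc
    have e2 : (L0 I).map h d = b := iP.1 e1
    rw [← e2]
    exact ConcreteCategory.congr_hom w' d
  · intro y
    obtain ⟨z, rfl⟩ := s2 y
    obtain ⟨b, rfl⟩ := iP.2 z
    exact ⟨(L0 I).map π b, ConcreteCategory.congr_hom nP b⟩

lemma coker_eta (M : ModuleCat.{u} A) :
    (I • ⊤ : Submodule A (cokernel ((eta I).app M) : ModuleCat.{u} A)) = ⊤ := by
  let F := Projective.over M
  let f : F ⟶ M := Projective.π M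
  let c : (adic I).obj F ⟶ (L0 I).obj M := tt (adic I) F ≫ (L0 I).map f
  have hc : Epi c := (ModuleCat.epi_iff_surjective c).2 (L0_cover I f)
  have hw : (adicOf I).app F ≫ c = f ≫ (eta I).app M := by
    rw [← eta_theta, Category.assoc]
    change (eta I).app F ≫ (theta I).app F ≫ tt (adic I) F ≫ (L0 I).map f = _
    rw [← Category.assoc ((theta I).app F), from_tt, Category.id_comp]
    exact ((eta I).naturality f).symm
  have h1 : Epi (cokernel.π ((adicOf I).app F) ≫ cokernel.map _ _ f c hw) := by
    rw [cokernel.π_desc]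
    infer_instance
  have := @epi_of_epi _ _ _ _ _ _ _ h1
  exact top_of_epi I (cokernel.map _ _ f c hw) (coker_adicOf I F)

/-- Maps out of `L₀ X` into an `L`-complete module are determined on `X`. -/
lemma L0_hom_ext {X Y : ModuleCat.{u} A} (hY : IsLComplete I Y) {g₁ g₂ : (L0 I).obj X ⟶ Y}
    (h : (eta I).app X ≫ g₁ = (eta I).app X ≫ g₂) : g₁ = g₂ := by
  have hY : IsIso ((eta I).app Y) := hY
  have hd : (eta I).app X ≫ (g₁ - g₂) = 0 := by rw [Preadditive.comp_sub, h, sub_self]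
  have hz : cokernel.desc _ _ hd = 0 := by
    ext q
    refine ((ConcreteCategory.isIso_iff_bijective ((eta I).app Y)).1 hY).1 ?_
    have hn := ConcreteCategory.congr_hom ((eta I).naturality (cokernel.desc _ _ hd)) q
    refine hn.trans ?_
    have h0 : (eta I).app _ q = 0 := L0_eq_zero I (coker_eta I X) _
    exact ((congrArg ((L0 I).map (cokernel.desc _ _ hd)) h0).trans (map_zero _)).trans
      (map_zero ((eta I).app Y).hom).symm
  have : g₁ - g₂ = 0 := by rw [← cokernel.π_desc _ _ hd, hz, comp_zero]
  exact sub_eq_zero.1 this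

/-- The extension of `f : X ⟶ Y` to `L₀ X ⟶ Y`, for `Y` an `L`-complete module. -/
def extend {X Y : ModuleCat.{u} A} (hY : IsLComplete I Y) (f : X ⟶ Y) : (L0 I).obj X ⟶ Y :=
  have : IsIso ((eta I).app Y) := hY
  (L0 I).map f ≫ inv ((eta I).app Y)

lemma eta_extend {X Y : ModuleCat.{u} A} (hY : IsLComplete I Y) (f : X ⟶ Y) :
    (eta I).app X ≫ extend I hY f = f := by
  have : IsIso ((eta I).app Y) := hY
  unfold extend
  rw [← Category.assoc, ← (eta I).naturality, Category.assoc]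
  exact (congrArg (f ≫ ·) (IsIso.hom_inv_id ((eta I).app Y))).trans (Category.comp_id f)

end Modules

section Hopf

/-- The ring `B`, regarded as an `A`-algebra through the ring homomorphism `f : A → B`. -/
def Via {A B : Type u} [CommRing A] [CommRing B] (_f : A →+* B) : Type u := B

instance {A B : Type u} [CommRing A] [CommRing B] (f : A →+* B) : CommRing (Via f) :=
  inferInstanceAs (CommRing B)

instance {A B : Type u} [CommRing A] [CommRing B] (f : A →+* B) : Algebra A (Via f) :=
  f.toAlgebra

/-- An element of `B` as an element of `Via f`. -/
def toVia {A B : Type u} [CommRing A] [CommRing B] (f : A →+* B) : B →+* Via f := RingHom.id B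

/-- For ring homomorphisms `f g : B → S` with `f ∘ r = g ∘ l`, the ring homomorphism
`B ⊗_A B → S`, `x ⊗ y ↦ f x * g y`; here `A` acts on the left factor through `r` and on the
right factor through `l`. -/
def pair {A B S : Type u} [CommRing A] [CommRing B] [CommRing S] {l r : A →+* B} (f g : B →+* S)
    (h : f.comp r = g.comp l) : (Via r ⊗[A] Via l) →+* S :=
  letI : Algebra A S := (f.comp r).toAlgebra
  (Algebra.TensorProduct.lift (R := A) (S := A) (A := Via r) (B := Via l) (C := S)
    { (f : B →+* S) with commutes' := fun _ => rfl }
    { (g : B →+* S) with commutes' := fun a => (congrArg (fun k : A →+* S => k a) h).symm }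
    (fun _ _ => Commute.all _ _)).toRingHom

lemma pair_tmul {A B S : Type u} [CommRing A] [CommRing B] [CommRing S] {l r : A →+* B}
    (f g : B →+* S) (h : f.comp r = g.comp l) (x y : B) :
    pair f g h (toVia r x ⊗ₜ toVia l y) = f x * g y := rfl

lemma pair_comp_left {A B S : Type u} [CommRing A] [CommRing B] [CommRing S] {l r : A →+* B}
    {D : B →+* Via r ⊗[A] Via l} (hD : ∀ a, D (l a) = toVia r (l a) ⊗ₜ 1)
    (f g : B →+* S) (h : f.comp r = g.comp l) : ((pair f g h).comp D).comp l = f.comp l := by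
  ext a
  have := pair_tmul f g h (l a) 1
  simp only [RingHom.comp_apply, hD]
  exact this.trans (by simp)

lemma pair_comp_right {A B S : Type u} [CommRing A] [CommRing B] [CommRing S] {l r : A →+* B}
    {D : B →+* Via r ⊗[A] Via l} (hD : ∀ a, D (r a) = 1 ⊗ₜ toVia l (r a))
    (f g : B →+* S) (h : f.comp r = g.comp l) : ((pair f g h).comp D).comp r = g.comp r := by
  ext a
  have := pair_tmul f g h 1 (r a)
  simp only [RingHom.comp_apply, hD]
  exact this.trans (by simp)

/-- A Hopf algebroid `(A, Ψ)`: a cogroupoid object in commutative rings. In `Ψ ⊗_A Ψ` the ring `A`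
acts on the left factor through the right unit and on the right factor through the left unit.
The identities between maps out of `Ψ` are written with `pair`, i.e. `pair f g ∘ Δ` is the composite
of two composable morphisms `f`, `g` of the groupoid of `S`-valued points; associativity for all
points is coassociativity of `Δ`. -/
structure HopfAlgebroid (A Ψ : Type u) [CommRing A] [CommRing Ψ] where
  /-- left unit -/
  etaL : A →+* Ψ
  /-- right unit -/
  etaR : A →+* Ψ
  /-- counit -/
  counit : Ψ →+* A
  /-- comultiplication -/
  comul : Ψ →+* Via etaR ⊗[A] Via etaL
  /-- conjugation -/
  antipode : Ψ →+* Ψ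
  counit_etaL : counit.comp etaL = RingHom.id A
  counit_etaR : counit.comp etaR = RingHom.id A
  comul_etaL : ∀ a, comul (etaL a) = toVia etaR (etaL a) ⊗ₜ 1
  comul_etaR : ∀ a, comul (etaR a) = 1 ⊗ₜ toVia etaL (etaR a)
  antipode_etaL : antipode.comp etaL = etaR
  antipode_etaR : antipode.comp etaR = etaL
  antipode_antipode : antipode.comp antipode = RingHom.id Ψ
  counit_comul : (pair (etaL.comp counit) (RingHom.id Ψ)
    (by rw [RingHom.comp_assoc, counit_etaR]; rfl)).comp comul = RingHom.id Ψ
  comul_counit : (pair (RingHom.id Ψ) (etaR.comp counit)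
    (by rw [RingHom.comp_assoc, counit_etaL]; rfl)).comp comul = RingHom.id Ψ
  coassoc : ∀ (S : Type u) [CommRing S] (f g h : Ψ →+* S)
    (hfg : f.comp etaR = g.comp etaL) (hgh : g.comp etaR = h.comp etaL),
    (pair ((pair f g hfg).comp comul) h ((pair_comp_right comul_etaR f g hfg).trans hgh)).comp comul =
      (pair f ((pair g h hgh).comp comul)
        (hfg.trans (pair_comp_left comul_etaL g h hgh).symm)).comp comul
  antipode_comul : (pair antipode (RingHom.id Ψ) antipode_etaR).comp comul = etaR.comp counit
  comul_antipode : (pair (RingHom.id Ψ) antipode antipode_etaL.symm).comp comul = etaL.comp counit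

variable {A B : Type u} [CommRing A] [CommRing B]

/-- The `B`-module `X`, regarded also as an `A`-module through `f : A → B`. -/
def Pull (_f : A →+* B) (X : Type u) : Type u := X

section
variable (f : A →+* B) (X : Type u) [AddCommGroup X] [Module B X]

instance : AddCommGroup (Pull f X) := inferInstanceAs (AddCommGroup X)
instance : Module B (Pull f X) := inferInstanceAs (Module B X)
instance : Module A (Pull f X) := Module.compHom X f
instance : SMulCommClass A B (Pull f X) where
  smul_comm a b x := smul_comm (f a) b (x : X)

end

/-- The `B`-module `X`, regarded as an `A`-module through `l : A → B`. -/
abbrev leftMod (l : A →+* B) (X : Type u) [AddCommGroup X] [Module B X] : ModuleCat.{u} A :=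
  ModuleCat.of A (Pull l X)

/-- For ring homomorphisms `l r : A → B`, a `B`-module `X` is an `A`-bimodule. This is `X ⊗_A M`,
formed with the right action of `A` on `X` (through `r`), as an `A`-module through the left action
of `A` on `X` (through `l`). -/
abbrev tens (l r : A →+* B) (X : Type u) [AddCommGroup X] [Module B X] (M : ModuleCat.{u} A) :
    ModuleCat.{u} A :=
  leftMod l (Pull r X ⊗[A] M)

section tens
variable {l r : A →+* B} {X X' : Type u} [AddCommGroup X] [Module B X] [AddCommGroup X'] [Module B X']
  {M N : ModuleCat.{u} A}

/-- The pure tensor `x ⊗ m`. -/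
def tm (l r : A →+* B) {X : Type u} [AddCommGroup X] [Module B X] {M : ModuleCat.{u} A}
    (x : X) (m : M) : tens l r X M := (show Pull r X from x) ⊗ₜ[A] m

lemma tm_add_left (x x' : X) (m : M) : tm l r (x + x') m = tm l r x m + tm l r x' m :=
  TensorProduct.add_tmul _ _ _

lemma tm_add_right (x : X) (m m' : M) : tm l r x (m + m') = tm l r x m + tm l r x m' :=
  TensorProduct.tmul_add _ _ _

lemma tm_smul (a : A) (x : X) (m : M) : tm l r (r a • x) m = tm l r x (a • m) :=
  TensorProduct.smul_tmul (R := A) (M := Pull r X) a x m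

lemma smul_tm (a : A) (x : X) (m : M) : a • tm l r x m = tm l r (l a • x) m := rfl

lemma tens_hom_ext {Y : ModuleCat.{u} A} {f g : tens l r X M ⟶ Y}
    (h : ∀ x m, f (tm l r x m) = g (tm l r x m)) : f = g := by
  ext t
  induction t using TensorProduct.induction_on with
  | zero => exact (map_zero f.hom).trans (map_zero g.hom).symm
  | tmul x m => exact h x m
  | add s t hs ht => 
    exact (map_add f.hom s t).trans ((congrArg₂ (· + ·) hs ht).trans (map_add g.hom s t).symm)

/-- The map `X ⊗_A M ⟶ Y` induced by a biadditive, balanced, left `A`-linear map. -/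
def tensLift {Y : ModuleCat.{u} A} (φ : X →+ M →+ Y) (hr : ∀ a x m, φ (r a • x) m = φ x (a • m))
    (hl : ∀ (a : A) x m, φ (l a • x) m = a • φ x m) : tens l r X M ⟶ Y :=
  ModuleCat.ofHom (X := Pull l (Pull r X ⊗[A] M))
    { toFun := TensorProduct.liftAddHom (M := Pull r X) (N := M) (R := A) φ hr
      map_add' := fun s t => map_add _ s t
      map_smul' := fun a (t : Pull r X ⊗[A] M) => by
        change TensorProduct.liftAddHom (M := Pull r X) (N := M) (R := A) φ hr (l a • t) =
          a • TensorProduct.liftAddHom (M := Pull r X) (N := M) (R := A) φ hr t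
        induction t using TensorProduct.induction_on with
        | zero => rw [smul_zero, map_zero, smul_zero]
        | tmul x m => exact hl a x m
        | add s t hs ht => rw [smul_add, map_add, map_add, smul_add, hs, ht] }

lemma tensLift_tm {Y : ModuleCat.{u} A} (φ : X →+ M →+ Y) (hr hl) (x : X) (m : M) :
    tensLift (l := l) (r := r) φ hr hl (tm l r x m) = φ x m := rfl

/-- `1 ⊗ f`. -/
def tensMap (l r : A →+* B) (X : Type u) [AddCommGroup X] [Module B X] (f : M ⟶ N) :
    tens l r X M ⟶ tens l r X N :=
  tensLift
    { toFun := fun x =>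
        { toFun := fun m => tm l r x (f m)
          map_zero' := by rw [map_zero]; exact TensorProduct.tmul_zero _ _
          map_add' := fun _ _ => by rw [map_add, tm_add_right] }
      map_zero' := by
        ext m
        exact TensorProduct.zero_tmul _ _
      map_add' := fun x y => by
        ext m
        exact tm_add_left _ _ _ }
    (fun a x m => by
      change tm l r (r a • x) (f m) = tm l r x (f (a • m))
      rw [tm_smul]
      exact congrArg _ (f.hom.map_smul a m).symm)
    (fun a x m => rfl)

lemma tensMap_tm (f : M ⟶ N) (x : X) (m : M) :
    tensMap l r X f (tm l r x m) = tm l r x (f m) := rfl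

/-- `g ⊗ 1`. -/
def tensMapLeft (l r : A →+* B) (g : X →ₗ[B] X') (M : ModuleCat.{u} A) :
    tens l r X M ⟶ tens l r X' M :=
  tensLift
    { toFun := fun x =>
        { toFun := fun m => tm l r (g x) m
          map_zero' := TensorProduct.tmul_zero _ _
          map_add' := fun _ _ => tm_add_right _ _ _ }
      map_zero' := by
        ext m
        change tm l r (g 0) m = 0
        rw [map_zero]
        exact TensorProduct.zero_tmul _ _
      map_add' := fun x y => by
        ext m
        change tm l r (g (x + y)) m = tm l r (g x) m + tm l r (g y) m
        rw [map_add, tm_add_left] }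
    (fun a x m => by
      change tm l r (g (r a • x)) m = tm l r (g x) (a • m)
      rw [map_smul, tm_smul])
    (fun a x m => by
      change tm l r (g (l a • x)) m = a • tm l r (g x) m
      rw [map_smul, smul_tm])

lemma tensMapLeft_tm (g : X →ₗ[B] X') (x : X) (m : M) :
    tensMapLeft l r g M (tm l r x m) = tm l r (g x) m := rfl

/-- The functor `M ↦ X ⊗_A M`. -/
abbrev tensFunctor (l r : A →+* B) (X : Type u) [AddCommGroup X] [Module B X] :
    ModuleCat.{u} A ⥤ ModuleCat.{u} A where
  obj M := tens l r X M
  map f := tensMap l r X f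
  map_id _ := tens_hom_ext fun _ _ => rfl
  map_comp _ _ := tens_hom_ext fun _ _ => rfl

/-- The map `X ⟶ X ⊗_A M`, `x ↦ x ⊗ m`. -/
def ins (l r : A →+* B) (X : Type u) [AddCommGroup X] [Module B X] (m : M) :
    leftMod l X ⟶ tens l r X M :=
  ModuleCat.ofHom (X := Pull l X) (Y := Pull l (Pull r X ⊗[A] M))
    { toFun := fun x => tm l r (show X from x) m
      map_add' := fun _ _ => tm_add_left _ _ _
      map_smul' := fun _ _ => rfl }

end tens

end Hopf

section Comonads

variable {A B : Type u} [CommRing A] [CommRing B]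

instance (I : Ideal A) : (L0 I).Additive := ⟨fun {_ _ f g} => leftDerived_zero_map_add _ f g⟩

section
variable {l r : A →+* B} {X : Type u} [AddCommGroup X] [Module B X] {M N : ModuleCat.{u} A}

instance : (tensFunctor l r X).Additive :=
  ⟨fun {_ _ f g} => tens_hom_ext fun x m => tm_add_right x (f m) (g m)⟩

/-- Multiplication by `b`, as a left `A`-linear map. -/
def mulMap (l : A →+* B) (X : Type u) [AddCommGroup X] [Module B X] (b : B) :
    leftMod l X ⟶ leftMod l X :=
  ModuleCat.ofHom (X := Pull l X) (Y := Pull l X)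
    { toFun := fun x => b • x
      map_add' := fun x y => smul_add b x y
      map_smul' := fun a x => smul_comm b (l a) (show X from x) }

lemma ins_apply (m : M) (x : X) : ins l r X m x = tm l r x m := rfl

lemma ins_add (m m' : M) : ins l r X (m + m') = ins l r X m + ins l r X m' := by
  ext x
  exact tm_add_right (show X from x) m m'

lemma ins_smul (a : A) (m : M) : ins l r X (a • m) = mulMap l X (r a) ≫ ins l r X m := by
  ext x
  exact (tm_smul a (show X from x) m).symm

lemma ins_tensMap (f : M ⟶ N) (m : M) : ins l r X m ≫ tensMap l r X f = ins l r X (f m) := rfl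

/-- For a functor `G` and a map `D : X ⟶ G X` of bimodules, the map `X ⊗_A M ⟶ G (X ⊗_A M)`,
`x ⊗ m ↦ G (y ↦ y ⊗ m) (D x)`. -/
def insLift (l r : A →+* B) (X : Type u) [AddCommGroup X] [Module B X]
    (G : ModuleCat.{u} A ⥤ ModuleCat.{u} A) [G.Additive]
    (D : leftMod l X ⟶ G.obj (leftMod l X))
    (hD : ∀ a, mulMap l X (r a) ≫ D = D ≫ G.map (mulMap l X (r a))) (M : ModuleCat.{u} A) :
    tens l r X M ⟶ G.obj (tens l r X M) :=
  tensLift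
    (AddMonoidHom.mk' (fun x => AddMonoidHom.mk' (fun m => G.map (ins l r X m) (D x))
        (fun m m' => by rw [ins_add, G.map_add]; rfl))
      (fun x y => by
        ext m
        change G.map (ins l r X m) (D.hom ((show Pull l X from x) + (show Pull l X from y))) = _
        rw [map_add]
        exact map_add (G.map (ins l r X m)).hom _ _))
    (fun a x m => by
      change G.map (ins l r X m) ((mulMap l X (r a) ≫ D) x) = G.map (ins l r X (a • m)) (D x)
      rw [hD, ins_smul, Functor.map_comp]
      rfl)
    (fun a x m => by
      change G.map (ins l r X m) (D.hom (a • (show Pull l X from x))) = a • G.map (ins l r X m) (D x)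
      rw [map_smul]
      exact (G.map (ins l r X m)).hom.map_smul a _)

lemma insLift_tm (G : ModuleCat.{u} A ⥤ ModuleCat.{u} A) [G.Additive]
    (D : leftMod l X ⟶ G.obj (leftMod l X)) (hD) (x : X) (m : M) :
    insLift l r X G D hD M (tm l r x m) = G.map (ins l r X m) (D x) := rfl

lemma insLift_nat (G : ModuleCat.{u} A ⥤ ModuleCat.{u} A) [G.Additive]
    (D : leftMod l X ⟶ G.obj (leftMod l X)) (hD) (f : M ⟶ N) :
    tensMap l r X f ≫ insLift l r X G D hD N = insLift l r X G D hD M ≫ G.map (tensMap l r X f) := by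
  refine tens_hom_ext fun x m => ?_
  change G.map (ins l r X (f m)) (D x) = G.map (tensMap l r X f) (G.map (ins l r X m) (D x))
  rw [← ins_tensMap, Functor.map_comp]
  rfl

/-- The action of `A` on `m`, `a ↦ a m`. -/
def smulMap (m : M) : ModuleCat.of A A ⟶ M := ModuleCat.ofHom (LinearMap.toSpanSingleton A M m)

lemma smulMap_add (m m' : M) : smulMap (m + m') = smulMap m + smulMap m' := by
  ext
  exact smul_add (1 : A) m m'

/-- For a functor `G` and a map `E : X ⟶ G A` of bimodules, the map `X ⊗_A M ⟶ G M`,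
`x ⊗ m ↦ G (a ↦ a m) (E x)`. -/
def actLift (l r : A →+* B) (X : Type u) [AddCommGroup X] [Module B X]
    (G : ModuleCat.{u} A ⥤ ModuleCat.{u} A) [G.Additive]
    (E : leftMod l X ⟶ G.obj (ModuleCat.of A A))
    (hE : ∀ a, mulMap l X (r a) ≫ E = E ≫ G.map (smulMap a)) (M : ModuleCat.{u} A) :
    tens l r X M ⟶ G.obj M :=
  tensLift
    (AddMonoidHom.mk' (fun x => AddMonoidHom.mk' (fun m => G.map (smulMap m) (E x))
        (fun m m' => by rw [smulMap_add, G.map_add]; rfl))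
      (fun x y => by
        ext m
        change G.map (smulMap m) (E.hom ((show Pull l X from x) + (show Pull l X from y))) = _
        rw [map_add]
        exact map_add (G.map (smulMap m)).hom _ _))
    (fun a x m => by
      change G.map (smulMap m) ((mulMap l X (r a) ≫ E) x) = G.map (smulMap (a • m)) (E x)
      have : smulMap (M := M) (a • m) = smulMap (M := ModuleCat.of A A) a ≫ smulMap m := by
        ext
        change (1 : A) • a • m = ((1 : A) • a) • m
        rw [one_smul, one_smul]
      rw [hE, this, Functor.map_comp]
      rfl)
    (fun a x m => by
      change G.map (smulMap m) (E.hom (a • (show Pull l X from x))) = a • G.map (smulMap m) (E x)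
      rw [map_smul]
      exact (G.map (smulMap m)).hom.map_smul a _)

lemma actLift_tm (G : ModuleCat.{u} A ⥤ ModuleCat.{u} A) [G.Additive]
    (E : leftMod l X ⟶ G.obj (ModuleCat.of A A)) (hE) (x : X) (m : M) :
    actLift l r X G E hE M (tm l r x m) = G.map (smulMap m) (E x) := rfl

lemma actLift_nat (G : ModuleCat.{u} A ⥤ ModuleCat.{u} A) [G.Additive]
    (E : leftMod l X ⟶ G.obj (ModuleCat.of A A)) (hE) (f : M ⟶ N) :
    tensMap l r X f ≫ actLift l r X G E hE N = actLift l r X G E hE M ≫ G.map f := by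
  refine tens_hom_ext fun x m => ?_
  change G.map (smulMap (f m)) (E x) = G.map f (G.map (smulMap m) (E x))
  have : smulMap (f m) = smulMap m ≫ f := by
    ext
    exact (f.hom.map_smul (1 : A) m).symm
  rw [this, Functor.map_comp]
  rfl

end

variable {Ψ : Type u} [CommRing Ψ] (H : HopfAlgebroid A Ψ)

namespace HopfAlgebroid

/-- The additive map `Ψ ⊗_A Ψ → Ψ ⊗_A Ψ`, `x ⊗ y ↦ x ⊗ y`, from the tensor product of rings to
the tensor product of modules. -/
def toTens : Via H.etaR ⊗[A] Via H.etaL →+ tens H.etaL H.etaR Ψ (leftMod H.etaL Ψ) :=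
  TensorProduct.liftAddHom (R := A) (M := Via H.etaR) (N := Via H.etaL)
    (AddMonoidHom.mk' (fun x => AddMonoidHom.mk'
      (fun y => tm H.etaL H.etaR (M := leftMod H.etaL Ψ) (show Ψ from x) y)
      (fun _ _ => tm_add_right _ _ _))
      (fun x y => by ext m; exact tm_add_left (M := leftMod H.etaL Ψ) _ _ _))
    (fun a x y => tm_smul (M := leftMod H.etaL Ψ) a (show Ψ from x) y)

lemma toTens_tmul (x y : Ψ) : H.toTens (toVia H.etaR x ⊗ₜ toVia H.etaL y) =
    tm H.etaL H.etaR (M := leftMod H.etaL Ψ) x y := rfl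

lemma via_induction {p : Via H.etaR ⊗[A] Via H.etaL → Prop} (t : Via H.etaR ⊗[A] Via H.etaL)
    (h0 : p 0) (h1 : ∀ x y : Ψ, p (toVia H.etaR x ⊗ₜ toVia H.etaL y))
    (h2 : ∀ s t, p s → p t → p (s + t)) : p t :=
  TensorProduct.induction_on t h0 h1 h2

/-- The comultiplication as a left `A`-linear map `Ψ ⟶ Ψ ⊗_A Ψ`. -/
def comulMap : leftMod H.etaL Ψ ⟶ tens H.etaL H.etaR Ψ (leftMod H.etaL Ψ) :=
  ModuleCat.ofHom (X := Pull H.etaL Ψ)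
    { toFun := fun x => H.toTens (H.comul x)
      map_add' := fun x y => by
        refine (congrArg H.toTens (map_add H.comul (show Ψ from x) (show Ψ from y))).trans ?_
        exact map_add _ _ _
      map_smul' := fun a x => by
        change H.toTens (H.comul (H.etaL a * (show Ψ from x))) = a • H.toTens (H.comul x)
        rw [map_mul, H.comul_etaL]
        induction H.comul x using H.via_induction with
        | h0 => rw [mul_zero, map_zero, smul_zero]
        | h1 x y =>
          rw [Algebra.TensorProduct.tmul_mul_tmul, one_mul]
          rfl
        | h2 s t hs ht => rw [mul_add, map_add, hs, ht, map_add, smul_add] }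

lemma comulMap_apply (x : Ψ) : H.comulMap x = H.toTens (H.comul x) := rfl

lemma comulMap_right (a : A) : mulMap H.etaL Ψ (H.etaR a) ≫ H.comulMap =
    H.comulMap ≫ (tensFunctor H.etaL H.etaR Ψ).map (mulMap H.etaL Ψ (H.etaR a)) := by
  ext x
  change H.toTens (H.comul (H.etaR a * (show Ψ from x))) =
    tensMap H.etaL H.etaR Ψ (mulMap H.etaL Ψ (H.etaR a)) (H.toTens (H.comul x))
  rw [map_mul, H.comul_etaR]
  induction H.comul x using H.via_induction with
  | h0 => rw [mul_zero, map_zero, map_zero]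
  | h1 x y =>
    rw [Algebra.TensorProduct.tmul_mul_tmul, one_mul]
    rfl
  | h2 s t hs ht => rw [mul_add, map_add, hs, ht, map_add, map_add]

/-- The counit as a left `A`-linear map `Ψ ⟶ A`. -/
def counitMap : leftMod H.etaL Ψ ⟶ ModuleCat.of A A :=
  ModuleCat.ofHom (X := Pull H.etaL Ψ)
    { toFun := fun x => H.counit x
      map_add' := fun x y => map_add H.counit _ _
      map_smul' := fun a x => by
        change H.counit (H.etaL a * (show Ψ from x)) = a * H.counit x
        rw [map_mul]
        exact congrArg (· * _) (congrArg (fun k : A →+* A => k a) H.counit_etaL) }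

lemma counitMap_right (a : A) : mulMap H.etaL Ψ (H.etaR a) ≫ H.counitMap =
    H.counitMap ≫ (𝟭 (ModuleCat.{u} A)).map (smulMap a) := by
  ext x
  change H.counit (H.etaR a * (show Ψ from x)) = H.counit x * a
  rw [map_mul, mul_comm]
  exact congrArg (_ * ·) (congrArg (fun k : A →+* A => k a) H.counit_etaR)

/-- `Δ ⊗ 1 : Ψ ⊗_A M ⟶ Ψ ⊗_A (Ψ ⊗_A M)`. -/
def delta (M : ModuleCat.{u} A) : tens H.etaL H.etaR Ψ M ⟶
    tens H.etaL H.etaR Ψ (tens H.etaL H.etaR Ψ M) :=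
  insLift H.etaL H.etaR Ψ (tensFunctor H.etaL H.etaR Ψ) H.comulMap H.comulMap_right M

/-- `ε ⊗ 1 : Ψ ⊗_A M ⟶ M`. -/
def eps (M : ModuleCat.{u} A) : tens H.etaL H.etaR Ψ M ⟶ M :=
  actLift H.etaL H.etaR Ψ (𝟭 _) H.counitMap H.counitMap_right M

lemma eps_tm {M : ModuleCat.{u} A} (x : Ψ) (m : M) :
    H.eps M (tm H.etaL H.etaR x m) = H.counit x • m := rfl

/-- `x ⊗ y ↦ x ⊗ (y ⊗ m)`. -/
def J {M : ModuleCat.{u} A} (m : M) : Via H.etaR ⊗[A] Via H.etaL →+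
    tens H.etaL H.etaR Ψ (tens H.etaL H.etaR Ψ M) :=
  (tensMap H.etaL H.etaR Ψ (ins H.etaL H.etaR Ψ m)).hom.toAddMonoidHom.comp H.toTens

lemma J_tmul {M : ModuleCat.{u} A} (m : M) (x y : Ψ) :
    H.J m (toVia H.etaR x ⊗ₜ toVia H.etaL y) = tm H.etaL H.etaR x (tm H.etaL H.etaR y m) := rfl

lemma delta_tm {M : ModuleCat.{u} A} (x : Ψ) (m : M) :
    H.delta M (tm H.etaL H.etaR x m) = H.J m (H.comul x) := rfl

lemma delta_eps (M : ModuleCat.{u} A) : H.delta M ≫ H.eps _ = 𝟙 _ := by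
  refine tens_hom_ext fun x m => ?_
  change H.eps _ (H.J m (H.comul x)) = tm H.etaL H.etaR x m
  have h : (pair (H.etaL.comp H.counit) (RingHom.id Ψ)
    (by rw [RingHom.comp_assoc, counit_etaR]; rfl)) (H.comul x) = x :=
    congrArg (fun k : Ψ →+* Ψ => k x) H.counit_comul
  conv_rhs => rw [← h]
  induction H.comul x using H.via_induction with
  | h0 => rw [map_zero, map_zero, map_zero]; exact (TensorProduct.zero_tmul _ _).symm
  | h1 x y => rfl
  | h2 s t hs ht => rw [map_add, map_add, map_add, hs, ht, tm_add_left]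

lemma delta_tensMap_eps (M : ModuleCat.{u} A) :
    H.delta M ≫ tensMap H.etaL H.etaR Ψ (H.eps M) = 𝟙 _ := by
  refine tens_hom_ext fun x m => ?_
  change tensMap H.etaL H.etaR Ψ (H.eps M) (H.J m (H.comul x)) = tm H.etaL H.etaR x m
  have h : (pair (RingHom.id Ψ) (H.etaR.comp H.counit)
    (by rw [RingHom.comp_assoc, counit_etaL]; rfl)) (H.comul x) = x :=
    congrArg (fun k : Ψ →+* Ψ => k x) H.comul_counit
  conv_rhs => rw [← h]
  induction H.comul x using H.via_induction with
  | h0 => rw [map_zero, map_zero, map_zero]; exact (TensorProduct.zero_tmul _ _).symm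
  | h1 x y =>
    rw [J_tmul, tensMap_tm, eps_tm, pair_tmul, ← tm_smul, mul_comm]
    rfl
  | h2 s t hs ht => rw [map_add, map_add, map_add, hs, ht, tm_add_left]

/-- The triple tensor product `Ψ ⊗_A (Ψ ⊗_A Ψ)` as a ring. -/
abbrev Triple : Type u :=
  Via H.etaR ⊗[A] Via ((Algebra.TensorProduct.includeLeftRingHom
    (R := A) (A := Via H.etaR) (B := Via H.etaL)).comp ((toVia H.etaR).comp H.etaL))

def f₁ : Ψ →+* H.Triple := Algebra.TensorProduct.includeLeftRingHom.comp (toVia H.etaR)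

def fR : (Via H.etaR ⊗[A] Via H.etaL) →+* H.Triple :=
  (Algebra.TensorProduct.includeRight.toRingHom).comp (toVia _)

def f₂ : Ψ →+* H.Triple :=
  H.fR.comp (Algebra.TensorProduct.includeLeftRingHom.comp (toVia H.etaR))

def f₃ : Ψ →+* H.Triple :=
  H.fR.comp (Algebra.TensorProduct.includeRight.toRingHom.comp (toVia H.etaL))

lemma f₁₂ : H.f₁.comp H.etaR = H.f₂.comp H.etaL := by
  ext a
  exact (Algebra.TensorProduct.algebraMap_apply' (R := A) (A := Via H.etaR)
    (B := Via ((Algebra.TensorProduct.includeLeftRingHom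
    (R := A) (A := Via H.etaR) (B := Via H.etaL)).comp ((toVia H.etaR).comp H.etaL))) a)

lemma f₂₃ : H.f₂.comp H.etaR = H.f₃.comp H.etaL := by
  ext a
  exact congrArg H.fR (Algebra.TensorProduct.algebraMap_apply' (R := A) (A := Via H.etaR)
    (B := Via H.etaL) a)

lemma pair₂₃ (t : Via H.etaR ⊗[A] Via H.etaL) : pair H.f₂ H.f₃ H.f₂₃ t = H.fR t := by
  induction t using H.via_induction with
  | h0 => rw [map_zero, map_zero]
  | h1 x y =>
    rw [pair_tmul]
    refine (map_mul H.fR _ _).symm.trans (congrArg H.fR ?_)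
    exact (Algebra.TensorProduct.tmul_mul_tmul _ _ _ _).trans (by rw [mul_one, one_mul])
  | h2 s t hs ht => rw [map_add, map_add, hs, ht]

lemma J_smul {M : ModuleCat.{u} A} (m : M) (a : A) (t : Via H.etaR ⊗[A] Via H.etaL) :
    H.J m ((toVia H.etaR (H.etaL a) ⊗ₜ 1) * t) = a • H.J m t := by
  induction t using H.via_induction with
  | h0 => rw [mul_zero, map_zero, smul_zero]
  | h1 x y =>
    rw [Algebra.TensorProduct.tmul_mul_tmul, one_mul]
    rfl
  | h2 s t hs ht => rw [mul_add, map_add, hs, ht, map_add, smul_add]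

/-- `x ⊗ t ↦ x ⊗ J m t`. -/
def K {M : ModuleCat.{u} A} (m : M) : H.Triple →+
    tens H.etaL H.etaR Ψ (tens H.etaL H.etaR Ψ (tens H.etaL H.etaR Ψ M)) :=
  TensorProduct.liftAddHom (R := A)
    (AddMonoidHom.mk' (fun x => AddMonoidHom.mk'
      (fun t => tm H.etaL H.etaR (show Ψ from x) (H.J m t))
      (fun s t => (congrArg (tm H.etaL H.etaR (show Ψ from x)) (map_add (H.J m) s t)).trans
        (tm_add_right _ _ _)))
      (fun x y => by ext t; exact tm_add_left _ _ _))
    (fun a x t => (tm_smul a (show Ψ from x) (H.J m t)).trans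
      (congrArg (tm H.etaL H.etaR (show Ψ from x)) (H.J_smul m a t).symm))

lemma f₁_mul_fR (x : Ψ) (t : Via H.etaR ⊗[A] Via H.etaL) : H.f₁ x * H.fR t =
    toVia H.etaR x ⊗ₜ toVia _ t :=
  (Algebra.TensorProduct.tmul_mul_tmul _ _ _ _).trans (by rw [mul_one, one_mul])

lemma K_tmul {M : ModuleCat.{u} A} (m : M) (x : Ψ) (t : Via H.etaR ⊗[A] Via H.etaL) :
    H.K m (H.f₁ x * H.fR t) = tm H.etaL H.etaR x (H.J m t) := by
  rw [f₁_mul_fR]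
  rfl

lemma delta_coassoc (M : ModuleCat.{u} A) :
    H.delta M ≫ tensMap H.etaL H.etaR Ψ (H.delta M) = H.delta M ≫ H.delta _ := by
  refine tens_hom_ext fun x m => ?_
  change tensMap H.etaL H.etaR Ψ (H.delta M) (H.J m (H.comul x)) = H.delta _ (H.J m (H.comul x))
  have h := congrArg (fun k : Ψ →+* H.Triple => H.K m (k x))
    (H.coassoc H.Triple H.f₁ H.f₂ H.f₃ H.f₁₂ H.f₂₃)
  refine Eq.trans ?_ (h.symm.trans ?_)
  · change _ = H.K m (pair H.f₁ ((pair H.f₂ H.f₃ H.f₂₃).comp H.comul)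
      (H.f₁₂.trans (pair_comp_left H.comul_etaL _ _ H.f₂₃).symm) (H.comul x))
    induction H.comul x using H.via_induction with
    | h0 => rw [map_zero, map_zero, map_zero, map_zero]
    | h1 x y =>
      rw [J_tmul, tensMap_tm, delta_tm, pair_tmul, RingHom.comp_apply, pair₂₃, K_tmul]
    | h2 s t hs ht => rw [map_add, map_add, map_add, map_add, hs, ht]
  · change H.K m (pair ((pair H.f₁ H.f₂ H.f₁₂).comp H.comul) H.f₃
      ((pair_comp_right H.comul_etaR _ _ H.f₁₂).trans H.f₂₃) (H.comul x)) = _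
    induction H.comul x using H.via_induction with
    | h0 => rw [map_zero, map_zero, map_zero, map_zero]
    | h1 x y =>
      rw [J_tmul, delta_tm, pair_tmul, RingHom.comp_apply]
      induction H.comul x using H.via_induction with
      | h0 => rw [map_zero, zero_mul, map_zero, map_zero]
      | h1 x z =>
        rw [pair_tmul, mul_assoc, J_tmul]
        have : H.f₂ z * H.f₃ y = H.fR (toVia H.etaR z ⊗ₜ toVia H.etaL y) := by
          rw [← pair₂₃, pair_tmul]
        rw [this, K_tmul, J_tmul]
      | h2 s t hs ht => rw [map_add, add_mul, map_add, hs, ht, map_add]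
    | h2 s t hs ht => rw [map_add, map_add, map_add, map_add, hs, ht]

/-- The comonad `M ↦ Ψ ⊗_A M` on `A`-modules. -/
def Gamma : Comonad (ModuleCat.{u} A) where
  toFunctor := tensFunctor H.etaL H.etaR Ψ
  ε := { app := H.eps, naturality := fun _ _ f => actLift_nat (𝟭 _) _ H.counitMap_right f }
  δ := { app := H.delta, naturality := fun _ _ f => insLift_nat _ _ H.comulMap_right f }
  coassoc := H.delta_coassoc
  left_counit := H.delta_eps
  right_counit := H.delta_tensMap_eps

/-- `Comod_Ψ`: left `Ψ`-comodules, i.e. `A`-modules `M` with a counital and coassociative map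
`M ⟶ Ψ ⊗_A M`. -/
abbrev Comod : Type (u + 1) := H.Gamma.Coalgebra

end HopfAlgebroid
end Comonads

section Completed

variable {A Ψ : Type u} [CommRing A] [CommRing Ψ]

lemma eta_nat_apply (I : Ideal A) {M N : ModuleCat.{u} A} (f : M ⟶ N) (x : M) :
    (L0 I).map f ((eta I).app M x) = (eta I).app N (f x) :=
  (ConcreteCategory.congr_hom ((eta I).naturality f) x).symm

lemma eta_nat (I : Ideal A) {M N : ModuleCat.{u} A} (f : M ⟶ N) :
    (eta I).app M ≫ (L0 I).map f = f ≫ (eta I).app N :=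
  ((eta I).naturality f).symm

namespace HopfAlgebroid

variable (H : HopfAlgebroid A Ψ) (I : Ideal A)

/-- `Ψ̂ = L₀ Ψ`, the `L`-completion of `Ψ` as a left `A`-module. -/
def PsiHat : Type u := (L0 I).obj (leftMod H.etaL Ψ)

instance : AddCommGroup (H.PsiHat I) := inferInstanceAs (AddCommGroup ((L0 I).obj _))

/-- `Ψ` acts on `Ψ̂` by functoriality of `L₀`. In particular `Ψ̂` is an `A`-bimodule; its right
`A`-module structure (through the right unit) is induced from the one of `Ψ`. -/
instance : Module Ψ (H.PsiHat I) where
  smul b x := (L0 I).map (mulMap H.etaL Ψ b) x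
  one_smul x := by
    change (L0 I).map (mulMap H.etaL Ψ 1) x = x
    have : mulMap H.etaL Ψ (1 : Ψ) = 𝟙 _ := by
      ext y; exact one_mul (show Ψ from y)
    rw [this, CategoryTheory.Functor.map_id]
    rfl
  mul_smul b c x := by
    change (L0 I).map (mulMap H.etaL Ψ (b * c)) x =
      (L0 I).map (mulMap H.etaL Ψ b) ((L0 I).map (mulMap H.etaL Ψ c) x)
    have : mulMap H.etaL Ψ (b * c) = mulMap H.etaL Ψ c ≫ mulMap H.etaL Ψ b := by
      ext y; exact mul_assoc b c (show Ψ from y)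
    rw [this, Functor.map_comp]
    rfl
  smul_zero b := map_zero ((L0 I).map (mulMap H.etaL Ψ b)).hom
  smul_add b x y := map_add ((L0 I).map (mulMap H.etaL Ψ b)).hom x y
  add_smul b c x := by
    change (L0 I).map (mulMap H.etaL Ψ (b + c)) x =
      (L0 I).map (mulMap H.etaL Ψ b) x + (L0 I).map (mulMap H.etaL Ψ c) x
    have : mulMap H.etaL Ψ (b + c) = mulMap H.etaL Ψ b + mulMap H.etaL Ψ c := by
      ext y; exact add_mul b c (show Ψ from y)
    rw [this, Functor.map_add]
    rfl
  zero_smul x := by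
    change (L0 I).map (mulMap H.etaL Ψ 0) x = 0
    have : mulMap H.etaL Ψ (0 : Ψ) = 0 := by
      ext y; exact zero_mul (show Ψ from y)
    rw [this, Functor.map_zero]
    rfl

/-- `η : Ψ → Ψ̂`, as a `Ψ`-linear map. -/
def toHat : Ψ →ₗ[Ψ] H.PsiHat I where
  toFun x := (eta I).app (leftMod H.etaL Ψ) x
  map_add' x y := map_add ((eta I).app (leftMod H.etaL Ψ)).hom x y
  map_smul' b x := (eta_nat_apply I (mulMap H.etaL Ψ b) x).symm

/-- `η : Ψ ⟶ Ψ̂`, as a left `A`-linear map. -/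
def toHatMap : leftMod H.etaL Ψ ⟶ leftMod H.etaL (H.PsiHat I) :=
  ModuleCat.ofHom (X := Pull H.etaL Ψ) (Y := Pull H.etaL (H.PsiHat I))
    { toFun := fun x => H.toHat I x
      map_add' := fun x y => map_add (H.toHat I) x y
      map_smul' := fun a x => map_smul (H.toHat I) (H.etaL a) (show Ψ from x) }

/-- The natural map `Ψ ⊗_A M ⟶ Ψ̂ ⊗_A M ⟶ L₀ (Ψ̂ ⊗_A M)`. -/
def j (M : ModuleCat.{u} A) : tens H.etaL H.etaR Ψ M ⟶
    (L0 I).obj (tens H.etaL H.etaR (H.PsiHat I) M) :=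
  tensMapLeft H.etaL H.etaR (H.toHat I) M ≫ (eta I).app _

/-- The functor `M ↦ Ψ̂ ⊠ M = L₀ (Ψ̂ ⊗_A M)`. -/
abbrev box : ModuleCat.{u} A ⥤ ModuleCat.{u} A where
  obj M := (L0 I).obj (tens H.etaL H.etaR (H.PsiHat I) M)
  map f := (L0 I).map (tensMap H.etaL H.etaR (H.PsiHat I) f)
  map_id M := (tensFunctor H.etaL H.etaR (H.PsiHat I) ⋙ L0 I).map_id M
  map_comp f g := (tensFunctor H.etaL H.etaR (H.PsiHat I) ⋙ L0 I).map_comp f g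

instance : (H.box I).Additive :=
  inferInstanceAs (tensFunctor H.etaL H.etaR (H.PsiHat I) ⋙ L0 I).Additive

lemma j_nat {M N : ModuleCat.{u} A} (f : M ⟶ N) :
    H.j I M ≫ (H.box I).map f = tensMap H.etaL H.etaR Ψ f ≫ H.j I N := by
  unfold j
  rw [Category.assoc]
  refine (congrArg (_ ≫ ·) (eta_nat I (tensMap H.etaL H.etaR (H.PsiHat I) f))).trans ?_
  rw [← Category.assoc, ← Category.assoc]
  refine congrArg (· ≫ _) ?_
  exact tens_hom_ext fun x m => rfl

variable [IsNoetherianRing A]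

/-- The left `A`-module structures of `Ψ̂` and of `L₀ Ψ` agree. -/
lemma etaL_smul (a : A) (x : H.PsiHat I) :
    H.etaL a • x = (show H.PsiHat I from a • (show (L0 I).obj (leftMod H.etaL Ψ) from x)) := by
  have h : (L0 I).map (mulMap H.etaL Ψ (H.etaL a)) = ModuleCat.ofHom (a • LinearMap.id) := by
    refine L0_hom_ext I (isLComplete_L0 I _) ?_
    rw [eta_nat]
    ext y
    exact ((eta I).app (leftMod H.etaL Ψ)).hom.map_smul a y
  exact ConcreteCategory.congr_hom h x

/-- The identity map from `Ψ̂` to `L₀ Ψ`. -/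
def hatOut : leftMod H.etaL (H.PsiHat I) ⟶ (L0 I).obj (leftMod H.etaL Ψ) :=
  ModuleCat.ofHom (X := Pull H.etaL (H.PsiHat I))
    { toFun := fun x => x
      map_add' := fun _ _ => rfl
      map_smul' := fun a x => H.etaL_smul I a x }

/-- The identity map from `L₀ Ψ` to `Ψ̂`. -/
def hatIn : (L0 I).obj (leftMod H.etaL Ψ) ⟶ leftMod H.etaL (H.PsiHat I) :=
  ModuleCat.ofHom (Y := Pull H.etaL (H.PsiHat I))
    { toFun := fun x => x
      map_add' := fun _ _ => rfl
      map_smul' := fun a x => (H.etaL_smul I a x).symm }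

/-- Maps from `Ψ̂ ⊠ M` into an `L`-complete module are determined on `Ψ ⊗_A M`. -/
lemma j_ext {M Y : ModuleCat.{u} A} (hY : IsLComplete I Y) {g₁ g₂ : (H.box I).obj M ⟶ Y}
    (h : H.j I M ≫ g₁ = H.j I M ≫ g₂) : g₁ = g₂ := by
  refine L0_hom_ext I hY (tens_hom_ext fun x m => ?_)
  have : H.hatIn I ≫ ins H.etaL H.etaR (H.PsiHat I) m ≫ (eta I).app _ ≫ g₁ =
      H.hatIn I ≫ ins H.etaL H.etaR (H.PsiHat I) m ≫ (eta I).app _ ≫ g₂ := by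
    refine L0_hom_ext I hY ?_
    ext y
    exact ConcreteCategory.congr_hom h (tm H.etaL H.etaR (show Ψ from y) m)
  exact ConcreteCategory.congr_hom this x

/-- The comultiplication `Δ̂ : Ψ̂ ⟶ Ψ̂ ⊠ Ψ̂`, obtained by applying `L₀` to
`Ψ ⟶ Ψ ⊗_A Ψ ⟶ Ψ̂ ⊗_A Ψ̂`. -/
def comulHat : leftMod H.etaL (H.PsiHat I) ⟶ (H.box I).obj (leftMod H.etaL (H.PsiHat I)) :=
  H.hatOut I ≫ (L0 I).map (H.comulMap ≫ tensMap H.etaL H.etaR Ψ (H.toHatMap I) ≫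
    tensMapLeft H.etaL H.etaR (H.toHat I) _)

lemma comulHat_right (a : A) : mulMap H.etaL (H.PsiHat I) (H.etaR a) ≫ H.comulHat I =
    H.comulHat I ≫ (H.box I).map (mulMap H.etaL (H.PsiHat I) (H.etaR a)) := by
  have h1 : mulMap H.etaL (H.PsiHat I) (H.etaR a) ≫ H.hatOut I =
    H.hatOut I ≫ (L0 I).map (mulMap H.etaL Ψ (H.etaR a)) := rfl
  have h2 : tensMap H.etaL H.etaR Ψ (mulMap H.etaL Ψ (H.etaR a)) ≫
      tensMap H.etaL H.etaR Ψ (H.toHatMap I) ≫ tensMapLeft H.etaL H.etaR (H.toHat I) _ =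
      (tensMap H.etaL H.etaR Ψ (H.toHatMap I) ≫ tensMapLeft H.etaL H.etaR (H.toHat I) _) ≫
        tensMap H.etaL H.etaR (H.PsiHat I) (mulMap H.etaL (H.PsiHat I) (H.etaR a)) := by
    refine tens_hom_ext fun x m => ?_
    exact congrArg (tm H.etaL H.etaR (M := leftMod H.etaL (H.PsiHat I)) (H.toHat I x))
      ((H.toHat I).map_smul (H.etaR a) m)
  unfold comulHat
  rw [← Category.assoc, h1, Category.assoc, ← Functor.map_comp, ← Category.assoc, H.comulMap_right]
  refine (congrArg (fun t => H.hatOut I ≫ (L0 I).map t) ?_).trans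
    ((congrArg (H.hatOut I ≫ ·) (Functor.map_comp (L0 I) _ _)).trans
      (Category.assoc _ _ _).symm)
  rw [Category.assoc, Category.assoc]
  exact congrArg (H.comulMap ≫ ·) h2

/-- The counit `ε̂ : Ψ̂ ⟶ Â = L₀ A`. -/
def counitHat : leftMod H.etaL (H.PsiHat I) ⟶ (L0 I).obj (ModuleCat.of A A) :=
  H.hatOut I ≫ (L0 I).map H.counitMap

lemma counitHat_right (a : A) : mulMap H.etaL (H.PsiHat I) (H.etaR a) ≫ H.counitHat I =
    H.counitHat I ≫ (L0 I).map (smulMap a) := by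
  have h1 : mulMap H.etaL (H.PsiHat I) (H.etaR a) ≫ H.hatOut I =
    H.hatOut I ≫ (L0 I).map (mulMap H.etaL Ψ (H.etaR a)) := rfl
  unfold counitHat
  rw [← Category.assoc, h1, Category.assoc, Category.assoc, ← Functor.map_comp, ← Functor.map_comp,
    H.counitMap_right]
  rfl

/-- `Δ̂ ⊠ 1 : Ψ̂ ⊠ M ⟶ Ψ̂ ⊠ (Ψ̂ ⊠ M)`: the map which extends
`Ψ̂ ⊗_A M ⟶ L₀ (Ψ̂ ⊗_A (Ψ̂ ⊗_A M))`, `x ⊗ m ↦ Δ̂ x ⊗ m`, followed by `1 ⊠ η`. -/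
def deltaHat (M : ModuleCat.{u} A) : (H.box I).obj M ⟶ (H.box I).obj ((H.box I).obj M) :=
  extend I (isLComplete_L0 I _)
    (insLift H.etaL H.etaR (H.PsiHat I) (H.box I) (H.comulHat I) (H.comulHat_right I) M ≫
      (H.box I).map ((eta I).app _))

/-- `ε̂ ⊠ 1 : Ψ̂ ⊠ M ⟶ Â ⊠ M ≅ L₀ M`: the map which extends `Ψ̂ ⊗_A M ⟶ L₀ M`,
`x ⊗ m ↦ ε̂ x * m`. -/
def epsHat (M : ModuleCat.{u} A) : (H.box I).obj M ⟶ (L0 I).obj M :=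
  extend I (isLComplete_L0 I _)
    (actLift H.etaL H.etaR (H.PsiHat I) (L0 I) (H.counitHat I) (H.counitHat_right I) M)

lemma j_deltaHat (M : ModuleCat.{u} A) :
    H.j I M ≫ H.deltaHat I M = H.delta M ≫ tensMap H.etaL H.etaR Ψ (H.j I M) ≫ H.j I _ := by
  unfold deltaHat
  rw [show H.j I M = tensMapLeft H.etaL H.etaR (H.toHat I) M ≫ (eta I).app _ from rfl,
    Category.assoc, eta_extend]
  refine tens_hom_ext fun x m => ?_
  refine (congrArg (fun z => (H.box I).map ((eta I).app (tens H.etaL H.etaR (H.PsiHat I) M))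
    ((H.box I).map (ins H.etaL H.etaR (H.PsiHat I) m) z))
    (eta_nat_apply I (M := leftMod H.etaL Ψ) (H.comulMap ≫
      tensMap H.etaL H.etaR Ψ (H.toHatMap I) ≫ tensMapLeft H.etaL H.etaR (H.toHat I) _) x)).trans ?_
  refine (congrArg (fun z => (H.box I).map ((eta I).app (tens H.etaL H.etaR (H.PsiHat I) M)) z)
    (eta_nat_apply I (tensMap H.etaL H.etaR (H.PsiHat I)
    (ins H.etaL H.etaR (H.PsiHat I) m)) _)).trans ?_
  refine (eta_nat_apply I (tensMap H.etaL H.etaR (H.PsiHat I) ((eta I).app _)) _).trans ?_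
  change _ = (eta I).app _ _
  refine congrArg ((eta I).app _) ?_
  have : (tensMap H.etaL H.etaR Ψ (H.toHatMap I) ≫
      tensMapLeft H.etaL H.etaR (H.toHat I) _) ≫
      tensMap H.etaL H.etaR (H.PsiHat I) (ins H.etaL H.etaR (H.PsiHat I) m) ≫
      tensMap H.etaL H.etaR (H.PsiHat I) ((eta I).app _) =
      tensMap H.etaL H.etaR Ψ (ins H.etaL H.etaR Ψ m) ≫ tensMap H.etaL H.etaR Ψ (H.j I M) ≫
        tensMapLeft H.etaL H.etaR (H.toHat I) _ :=
    tens_hom_ext fun y z => rfl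
  exact ConcreteCategory.congr_hom this (H.comulMap x)

lemma j_epsHat (M : ModuleCat.{u} A) :
    H.j I M ≫ H.epsHat I M = H.eps M ≫ (eta I).app M := by
  unfold epsHat
  rw [show H.j I M = tensMapLeft H.etaL H.etaR (H.toHat I) M ≫ (eta I).app _ from rfl,
    Category.assoc, eta_extend]
  refine tens_hom_ext fun x m => ?_
  refine (congrArg (fun z => (L0 I).map (smulMap m) z)
    (eta_nat_apply I (M := leftMod H.etaL Ψ) H.counitMap x)).trans ?_
  exact eta_nat_apply I (smulMap m) (H.counit x)

end HopfAlgebroid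
end Completed

section CompletedComonad

/-- The category of `L`-complete modules, a full subcategory of all `A`-modules. -/
abbrev LMod {A : Type u} [CommRing A] (I : Ideal A) : Type (u + 1) :=
  (IsLComplete I).FullSubcategory

variable {A Ψ : Type u} [CommRing A] [CommRing Ψ]

namespace HopfAlgebroid

variable (H : HopfAlgebroid A Ψ) (I : Ideal A)

lemma delta_nat {M N : ModuleCat.{u} A} (f : M ⟶ N) :
    tensMap H.etaL H.etaR Ψ f ≫ H.delta N =
      H.delta M ≫ tensMap H.etaL H.etaR Ψ (tensMap H.etaL H.etaR Ψ f) :=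
  H.Gamma.δ.naturality f

lemma eps_nat {M N : ModuleCat.{u} A} (f : M ⟶ N) :
    tensMap H.etaL H.etaR Ψ f ≫ H.eps N = H.eps M ≫ f :=
  H.Gamma.ε.naturality f

lemma tensMap_comp {M N K : ModuleCat.{u} A} (f : M ⟶ N) (g : N ⟶ K) :
    tensMap H.etaL H.etaR Ψ (f ≫ g) = tensMap H.etaL H.etaR Ψ f ≫ tensMap H.etaL H.etaR Ψ g :=
  (tensFunctor H.etaL H.etaR Ψ).map_comp f g

lemma tensMap_id (M : ModuleCat.{u} A) :
    tensMap H.etaL H.etaR Ψ (𝟙 M) = 𝟙 (tens H.etaL H.etaR Ψ M) :=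
  (tensFunctor H.etaL H.etaR Ψ).map_id M

/-- The coaction `L₀ M ⟶ L₀ (Ψ ⊗_A M) ⟶ L₀ (Ψ̂ ⊗_A L₀ M) = Ψ̂ ⊠ L₀ M` on the `L`-completion of
a comodule. -/
def coactHat {M : ModuleCat.{u} A} (c : M ⟶ tens H.etaL H.etaR Ψ M) :
    (L0 I).obj M ⟶ (H.box I).obj ((L0 I).obj M) :=
  (L0 I).map (c ≫ tensMap H.etaL H.etaR Ψ ((eta I).app M) ≫
    tensMapLeft H.etaL H.etaR (H.toHat I) _)

lemma eta_coactHat {M : ModuleCat.{u} A} (c : M ⟶ tens H.etaL H.etaR Ψ M) :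
    (eta I).app M ≫ H.coactHat I c = c ≫ tensMap H.etaL H.etaR Ψ ((eta I).app M) ≫ H.j I _ := by
  unfold coactHat
  rw [eta_nat, Category.assoc, Category.assoc]
  rfl

variable [IsNoetherianRing A]

lemma deltaHat_nat {M N : ModuleCat.{u} A} (f : M ⟶ N) :
    (H.box I).map f ≫ H.deltaHat I N = H.deltaHat I M ≫ (H.box I).map ((H.box I).map f) := by
  refine H.j_ext I (isLComplete_L0 I _) ?_
  rw [← Category.assoc, j_nat, Category.assoc, j_deltaHat, ← Category.assoc, delta_nat,
    ← Category.assoc (H.j I M), j_deltaHat, Category.assoc, Category.assoc, Category.assoc, j_nat,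
    ← Category.assoc (tensMap _ _ _ _), ← tensMap_comp, ← Category.assoc (tensMap _ _ _ _),
    ← tensMap_comp, j_nat]

lemma epsHat_nat {M N : ModuleCat.{u} A} (f : M ⟶ N) :
    (H.box I).map f ≫ H.epsHat I N = H.epsHat I M ≫ (L0 I).map f := by
  refine H.j_ext I (isLComplete_L0 I _) ?_
  rw [← Category.assoc, j_nat, Category.assoc, j_epsHat, ← Category.assoc, eps_nat,
    ← Category.assoc, j_epsHat, Category.assoc, Category.assoc, eta_nat]

lemma deltaHat_coassoc (M : ModuleCat.{u} A) :
    H.deltaHat I M ≫ (H.box I).map (H.deltaHat I M) = H.deltaHat I M ≫ H.deltaHat I _ := by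
  refine H.j_ext I (isLComplete_L0 I _) ?_
  rw [← Category.assoc, ← Category.assoc, j_deltaHat]
  simp only [Category.assoc]
  rw [j_nat, j_deltaHat, ← Category.assoc (tensMap _ _ _ _), ← tensMap_comp, j_deltaHat,
    tensMap_comp]
  simp only [Category.assoc]
  rw [← Category.assoc (H.delta M), delta_coassoc]
  simp only [Category.assoc]
  rw [← Category.assoc (tensMap _ _ _ _) (H.delta _), delta_nat, tensMap_comp]
  simp only [Category.assoc]

/-- `ε̂` on an `L`-complete module `N`: the composite `Ψ̂ ⊠ N ⟶ L₀ N ≅ N`. -/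
def epsHat' {N : ModuleCat.{u} A} (hN : IsLComplete I N) : (H.box I).obj N ⟶ N :=
  have : IsIso ((eta I).app N) := hN
  H.epsHat I N ≫ inv ((eta I).app N)

lemma j_epsHat' {N : ModuleCat.{u} A} (hN : IsLComplete I N) :
    H.j I N ≫ H.epsHat' I hN = H.eps N := by
  have : IsIso ((eta I).app N) := hN
  unfold epsHat'
  rw [← Category.assoc, j_epsHat, Category.assoc]
  exact (congrArg (_ ≫ ·) (IsIso.hom_inv_id ((eta I).app N))).trans (Category.comp_id _)

lemma deltaHat_epsHat' (N : ModuleCat.{u} A) :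
    H.deltaHat I N ≫ H.epsHat' I (isLComplete_L0 I _) = 𝟙 ((H.box I).obj N) := by
  refine H.j_ext I (isLComplete_L0 I _) ?_
  rw [← Category.assoc, j_deltaHat]
  simp only [Category.assoc]
  rw [j_epsHat', eps_nat, ← Category.assoc]
  exact (congrArg (· ≫ _) (H.delta_eps N)).trans
    ((Category.id_comp _).trans (Category.comp_id _).symm)

lemma deltaHat_map_epsHat' {N : ModuleCat.{u} A} (hN : IsLComplete I N) :
    H.deltaHat I N ≫ (H.box I).map (H.epsHat' I hN) = 𝟙 ((H.box I).obj N) := by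
  refine H.j_ext I (isLComplete_L0 I _) ?_
  rw [← Category.assoc, j_deltaHat]
  simp only [Category.assoc]
  rw [j_nat, ← Category.assoc (tensMap _ _ _ _), ← tensMap_comp, j_epsHat', ← Category.assoc]
  exact (congrArg (· ≫ _) (H.delta_tensMap_eps N)).trans
    ((Category.id_comp _).trans (Category.comp_id _).symm)

/-- The comonad `N ↦ Ψ̂ ⊠ N` on `L`-complete modules. -/
def GammaHat : Comonad (LMod I) where
  obj N := ⟨(H.box I).obj N.obj, isLComplete_L0 I _⟩
  map f := ObjectProperty.homMk ((H.box I).map f.hom)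
  map_id N := ObjectProperty.hom_ext _ ((H.box I).map_id N.obj)
  map_comp f g := ObjectProperty.hom_ext _ ((H.box I).map_comp f.hom g.hom)
  ε :=
    { app := fun N => ObjectProperty.homMk (H.epsHat' I N.property)
      naturality := fun N K f => ObjectProperty.hom_ext _ (by
        refine H.j_ext I K.property ?_
        change H.j I N.obj ≫ (H.box I).map f.hom ≫ H.epsHat' I K.property =
          H.j I N.obj ≫ H.epsHat' I N.property ≫ f.hom
        rw [← Category.assoc, j_nat, Category.assoc, j_epsHat', eps_nat, ← Category.assoc,
          j_epsHat']) }
  δ :=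
    { app := fun N => ObjectProperty.homMk (H.deltaHat I N.obj)
      naturality := fun N K f => ObjectProperty.hom_ext _ (H.deltaHat_nat I f.hom) }
  coassoc N := ObjectProperty.hom_ext _ (H.deltaHat_coassoc I N.obj)
  left_counit N := ObjectProperty.hom_ext _ (H.deltaHat_epsHat' I N.obj)
  right_counit N := ObjectProperty.hom_ext _ (H.deltaHat_map_epsHat' I N.property)

/-- `L`-complete `Ψ̂`-comodules: `L`-complete modules `N` with a counital and coassociative map
`N ⟶ Ψ̂ ⊠ N`. -/
abbrev ComodHat : Type (u + 1) := (H.GammaHat I).Coalgebra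

lemma coactHat_counit {M : ModuleCat.{u} A} (c : M ⟶ tens H.etaL H.etaR Ψ M)
    (h : c ≫ H.eps M = 𝟙 M) :
    H.coactHat I c ≫ H.epsHat' I (isLComplete_L0 I M) = 𝟙 ((L0 I).obj M) := by
  refine L0_hom_ext I (isLComplete_L0 I _) ?_
  rw [← Category.assoc, eta_coactHat]
  simp only [Category.assoc]
  rw [j_epsHat', eps_nat, ← Category.assoc, h]
  exact (Category.id_comp _).trans (Category.comp_id _).symm

lemma coactHat_coassoc {M : ModuleCat.{u} A} (c : M ⟶ tens H.etaL H.etaR Ψ M)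
    (h : c ≫ H.delta M = c ≫ tensMap H.etaL H.etaR Ψ c) :
    H.coactHat I c ≫ H.deltaHat I _ = H.coactHat I c ≫ (H.box I).map (H.coactHat I c) := by
  refine L0_hom_ext I (isLComplete_L0 I _) ?_
  rw [← Category.assoc, ← Category.assoc, eta_coactHat]
  simp only [Category.assoc]
  rw [j_deltaHat, ← Category.assoc (tensMap _ _ _ _), delta_nat, Category.assoc,
    ← Category.assoc c, h, j_nat, ← Category.assoc (tensMap _ _ _ ((eta I).app M)),
    ← tensMap_comp, eta_coactHat]
  simp only [tensMap_comp, Category.assoc]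

lemma coactHat_nat {M N : ModuleCat.{u} A} (c : M ⟶ tens H.etaL H.etaR Ψ M)
    (d : N ⟶ tens H.etaL H.etaR Ψ N) (f : M ⟶ N) (h : c ≫ tensMap H.etaL H.etaR Ψ f = f ≫ d) :
    H.coactHat I c ≫ (H.box I).map ((L0 I).map f) = (L0 I).map f ≫ H.coactHat I d := by
  refine L0_hom_ext I (isLComplete_L0 I _) ?_
  rw [← Category.assoc, ← Category.assoc, eta_coactHat, eta_nat]
  simp only [Category.assoc]
  rw [eta_coactHat, j_nat, ← Category.assoc (tensMap _ _ _ _), ← tensMap_comp, eta_nat,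
    ← Category.assoc f, ← h, tensMap_comp]
  simp only [Category.assoc]

/-- The `L`-completion functor from comodules to `L`-complete comodules. -/
def L0Comod : H.Comod ⥤ H.ComodHat I where
  obj M :=
    { A := ⟨(L0 I).obj M.A, isLComplete_L0 I _⟩
      a := ObjectProperty.homMk (H.coactHat I M.a)
      counit := ObjectProperty.hom_ext _ (H.coactHat_counit I M.a M.counit)
      coassoc := ObjectProperty.hom_ext _ (H.coactHat_coassoc I M.a M.coassoc) }
  map {M N} f :=
    { f := ObjectProperty.homMk ((L0 I).map f.f)
      h := ObjectProperty.hom_ext _ (H.coactHat_nat I M.a N.a f.f f.h) }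
  map_id M := Comonad.Coalgebra.Hom.ext (ObjectProperty.hom_ext _ ((L0 I).map_id M.A))
  map_comp f g := Comonad.Coalgebra.Hom.ext (ObjectProperty.hom_ext _ ((L0 I).map_comp f.f g.f))

/-- The extended `L`-complete comodule `Ψ̂ ⊠ N` of a module `N`, with coaction `Δ̂ ⊠ 1`. -/
def extendedHat : ModuleCat.{u} A ⥤ H.ComodHat I where
  obj N :=
    { A := ⟨(H.box I).obj N, isLComplete_L0 I _⟩
      a := ObjectProperty.homMk (H.deltaHat I N)
      counit := ObjectProperty.hom_ext _ (H.deltaHat_epsHat' I N)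
      coassoc := ObjectProperty.hom_ext _ (H.deltaHat_coassoc I N).symm }
  map f :=
    { f := ObjectProperty.homMk ((H.box I).map f)
      h := ObjectProperty.hom_ext _ (H.deltaHat_nat I f).symm }
  map_id N := Comonad.Coalgebra.Hom.ext (ObjectProperty.hom_ext _ ((H.box I).map_id N))
  map_comp f g := Comonad.Coalgebra.Hom.ext (ObjectProperty.hom_ext _ ((H.box I).map_comp f g))

end HopfAlgebroid
end CompletedComonad

end

end LComp

/-!
Everything rests on one square of functors: the completion of a comodule, with its coaction
forgotten, is the completion of the underlying module (`forgetL0Iso`).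

The two forgetful functors are comonadic, and `L₀` from modules to `L`-complete modules is left
adjoint to the inclusion (`L0Adj`). Since `Ψ` is flat over `A` through the right unit as well (the
antipode exchanges the units), the comonad `Ψ ⊗_A -` is left exact and comodules have equalizers.
The adjoint lifting theorem then gives the right adjoint of completion on comodules
(`L0Comod_isLeftAdjoint`). Both `ι ∘ ε̂^*` and `ε^* ∘ ι_A` are right adjoint to the diagonal of the
square, so they are isomorphic (`cofreeIso`).

For a module `N` that is not `L`-complete it remains to compare `Ψ̂ ⊠ N` with `Ψ̂ ⊠ L₀ N`
(`boxEta_bijective`). Here `Ψ̂` may be replaced by any `Ψ`-module `X`. The cokernel of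
`η : N ⟶ L₀ N` is `I`-divisible; as `I` is invariant, so is its tensor product with `X`, and `L₀`
annihilates `I`-divisible modules. This gives surjectivity for all `X` and `N`. By the four lemma and
right exactness in both variables, injectivity follows from the case of `X` free over `Ψ` and `N`
projective over `A`. In that case `X ⊗_A N` is flat for the left `A`-action, so `L₀ (X ⊗_A N)` embeds
in the `I`-adic completion of `X ⊗_A N` (`theta_injective_of_flat`). By invariance again,
`X ⊗_A L₀ N ⟶ X ⊗_A (N / Iⁿ N) ⟶ (X ⊗_A N) / Iⁿ` retracts the map induced by `η` modulo `Iⁿ`, so this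
completion embeds in the completion of `X ⊗_A L₀ N` (`adic_map_tensMap_eta_injective`).
-/

namespace LComp

noncomputable section

/-! ### The completion of flat modules -/

section FlatCompletion

variable {A : Type u} [CommRing A] (I : Ideal A)

/-- For a flat quotient `F` of `P` with kernel `K`, `K ∩ J P ⊆ J K`. This is the vanishing of
`Tor₁ (A / J, F)`, expressed through the equational criterion for flatness. -/
lemma ker_inf_smul_top_le {P F : Type*} [AddCommGroup P] [Module A P] [AddCommGroup F] [Module A F]
    [Module.Flat A F] (f : P →ₗ[A] F) (hf : Function.Surjective f) (J : Ideal A) (x : P)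
    (hx : x ∈ (J • ⊤ : Submodule A P)) (h0 : f x = 0) :
    ∃ k ∈ (J • ⊤ : Submodule A (LinearMap.ker f)), (k : P) = x := by
  obtain ⟨n, a, p, rfl⟩ : ∃ (n : ℕ) (a : Fin n → J) (p : Fin n → P), ∑ i, (a i : A) • p i = x := by
    clear h0
    induction hx using Submodule.smul_induction_on' with
    | smul r hr m _ => exact ⟨1, fun _ => ⟨r, hr⟩, fun _ => m, by simp⟩
    | add x _ y _ hx hy =>
      obtain ⟨n, a, p, rfl⟩ := hx
      obtain ⟨m, b, q, rfl⟩ := hy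
      exact ⟨n + m, Fin.append a b, Fin.append p q, by simp [Fin.sum_univ_add]⟩
  have h1 : ∑ i, (a i : A) • f (p i) = 0 := by simpa using h0
  obtain ⟨k, b, y, hy, hb⟩ := Module.Flat.isTrivialRelation_of_sum_smul_eq_zero h1
  choose q hq using fun j => hf (y j)
  have hk (i) : p i - ∑ j, b i j • q j ∈ LinearMap.ker f := by
    simp [hq, ← hy]
  refine ⟨∑ i, (a i : A) • ⟨_, hk i⟩, Submodule.sum_mem _ fun i _ =>
    Submodule.smul_mem_smul (a i).2 trivial, ?_⟩
  -- the correction terms cancel, because the coefficients `∑ i, a i * b i j` vanish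
  have h2 : ∑ i, (a i : A) • ∑ j, b i j • q j = 0 := by
    simp_rw [Finset.smul_sum, smul_smul]
    rw [Finset.sum_comm]
    simp_rw [← Finset.sum_smul, hb, zero_smul, Finset.sum_const_zero]
  simp [smul_sub, h2]

/-- Completion is exact at `P` on `0 → K → P → F → 0` for flat `F`: preimages in `K` chosen modulo
each `Iⁿ P` form a Cauchy sequence for the `I`-adic topology of `K`. -/
lemma exists_adic_map_ker {P F : Type u} [AddCommGroup P] [Module A P] [AddCommGroup F] [Module A F]
    [Module.Flat A F] (f : P →ₗ[A] F) (hf : Function.Surjective f) (y : AdicCompletion I P)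
    (hy : AdicCompletion.map I f y = 0) :
    ∃ k, AdicCompletion.map I (LinearMap.ker f).subtype k = y := by
  obtain ⟨y, rfl⟩ := AdicCompletion.mk_surjective I P y
  have h1 (n : ℕ) : f (y n) ∈ (I ^ n • ⊤ : Submodule A F) := by
    have := congrArg (fun z => z.val n) hy
    rw [AdicCompletion.map_mk] at this
    exact (Submodule.Quotient.mk_eq_zero _).1 this
  have h2 (n : ℕ) : ∃ k : LinearMap.ker f, y n - k ∈ (I ^ n • ⊤ : Submodule A P) := by
    have h := h1 n
    rw [← LinearMap.range_eq_top.2 hf, ← Submodule.map_top, ← Submodule.map_smul''] at h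
    obtain ⟨z, hz, hzy⟩ := h
    exact ⟨⟨y n - z, by simp [hzy]⟩, by simpa using hz⟩
  choose k hk using h2
  refine ⟨AdicCompletion.mk I _ (AdicCompletion.AdicCauchySequence.mk I _ k fun n => ?_), ?_⟩
  · rw [SModEq.sub_mem]
    have h3 : (k n - k (n + 1) : P) ∈ (I ^ n • ⊤ : Submodule A P) := by
      have e1 := (Submodule.Quotient.eq _).1 (AdicCompletion.AdicCauchySequence.mk_eq_mk n.le_succ y)
      have e2 : y (n + 1) - k (n + 1) ∈ (I ^ n • ⊤ : Submodule A P) :=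
        Submodule.smul_mono_left (Ideal.pow_le_pow_right n.le_succ) (hk (n + 1))
      have := sub_mem (sub_mem e2 e1) (hk n)
      convert this using 1
      abel
    obtain ⟨z, hz, hz'⟩ := ker_inf_smul_top_le f hf (I ^ n) _ h3 (by simp)
    rwa [show k n - k (n + 1) = z from Subtype.ext hz'.symm]
  · refine AdicCompletion.ext fun n => ?_
    rw [AdicCompletion.map_mk]
    refine (Submodule.Quotient.eq _).2 ?_
    rw [← neg_mem_iff, neg_sub]
    exact hk n

/-- On a flat module, `L₀` embeds in the `I`-adic completion: an element of `L₀ F` comes from the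
completion of a projective cover `P` of `F`; if it dies in the completion of `F`, it comes from the
completion of the kernel of `P ⟶ F`, and therefore vanishes in `L₀ F`. -/
lemma theta_injective_of_flat (F : ModuleCat.{u} A) [Module.Flat A F] :
    Function.Injective ((theta I).app F) := by
  rw [injective_iff_map_eq_zero]
  intro x hx
  let f := Projective.π F
  have hf : Function.Surjective f := (ModuleCat.epi_iff_surjective f).1 inferInstance
  obtain ⟨y, rfl⟩ := L0_cover I f x
  have h1 : tt (adic I) _ ≫ (L0 I).map f ≫ (theta I).app F = (adic I).map f := by
    rw [NatTrans.naturality, ← Category.assoc, tt_from, Category.id_comp]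
  obtain ⟨k, rfl⟩ := exists_adic_map_ker I f.hom hf y
    ((ConcreteCategory.congr_hom h1 y).symm.trans hx)
  let i : ModuleCat.of A (LinearMap.ker f.hom) ⟶ Projective.over F :=
    ModuleCat.ofHom (LinearMap.ker f.hom).subtype
  have hi : i ≫ f = 0 := by
    ext z
    exact z.2
  let e := Projective.π (ModuleCat.of A (LinearMap.ker f.hom))
  obtain ⟨k, rfl⟩ := adic_map_surj I e k
  have key : (adic I).map e ≫ (adic I).map i ≫ tt (adic I) _ ≫ (L0 I).map f = 0 := by
    rw [← Functor.map_comp_assoc, ← tt_nat_assoc, ← Functor.map_comp, Category.assoc, hi,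
      comp_zero, leftDerived_map_zero, comp_zero]
  exact ConcreteCategory.congr_hom key k

end FlatCompletion

/-! ### Tensor products with bimodules -/

section Tensor

variable {A B : Type u} [CommRing A] [CommRing B] {l r : A →+* B}

lemma flat_pull (hl : l.Flat) (X : Type u) [AddCommGroup X] [Module B X] [Module.Flat B X] :
    Module.Flat A (Pull l X) := by
  let : Algebra A B := l.toAlgebra
  have : Module.Flat A B := hl
  have : IsScalarTower A B (Pull l X) := ⟨fun a b x => mul_smul (l a) b (show X from x)⟩
  have : Module.Flat B (Pull l X) := inferInstanceAs (Module.Flat B X)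
  exact Module.Flat.trans A B (Pull l X)

lemma projective_pull_tensor (X : Type u) [AddCommGroup X] [Module B X] [Module.Projective B X]
    (M : Type u) [AddCommGroup M] [Module A M] [Module.Projective A M] :
    Module.Projective B (Pull r X ⊗[A] M) := by
  let : Algebra A B := r.toAlgebra
  have : IsScalarTower A B (Pull r X) := ⟨fun a b x => mul_smul (r a) b (show X from x)⟩
  have : Module.Projective B (Pull r X) := inferInstanceAs (Module.Projective B X)
  exact Module.Projective.tensorProduct

lemma flat_tens (hl : l.Flat) (X : Type u) [AddCommGroup X] [Module B X] [Module.Projective B X]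
    (M : ModuleCat.{u} A) [Module.Projective A M] : Module.Flat A (tens l r X M) := by
  have := projective_pull_tensor (r := r) X M
  exact flat_pull hl (Pull r X ⊗[A] M)

/-- Right exactness of `X ⊗_A M` in `M`. -/
lemma tens_exact (X : Type u) [AddCommGroup X] [Module B X] {M N K : ModuleCat.{u} A}
    (f : M ⟶ N) (g : N ⟶ K) (hfg : Function.Exact f g) (hg : Function.Surjective g) :
    Function.Exact (tensMap l r X f) (tensMap l r X g) :=
  _root_.lTensor_exact (Pull r X) (f := f.hom) (g := g.hom) hfg hg

lemma tens_surjective (X : Type u) [AddCommGroup X] [Module B X] {M N : ModuleCat.{u} A}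
    (f : M ⟶ N) (hf : Function.Surjective f) : Function.Surjective (tensMap l r X f) :=
  LinearMap.lTensor_surjective (Pull r X) hf

/-- A `B`-linear map, as an `A`-linear map. -/
def pullMap (r : A →+* B) {X Y : Type u} [AddCommGroup X] [Module B X] [AddCommGroup Y] [Module B Y]
    (g : X →ₗ[B] Y) : Pull r X →ₗ[A] Pull r Y where
  toFun := g
  map_add' := g.map_add
  map_smul' a x := g.map_smul (r a) x

/-- Right exactness of `X ⊗_A M` in `X`. -/
lemma tens_exact_left {X Y Z : Type u} [AddCommGroup X] [Module B X] [AddCommGroup Y] [Module B Y]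
    [AddCommGroup Z] [Module B Z] (f : X →ₗ[B] Y) (g : Y →ₗ[B] Z) (hfg : Function.Exact f g)
    (hg : Function.Surjective g) (M : ModuleCat.{u} A) :
    Function.Exact (tensMapLeft l r f M) (tensMapLeft l r g M) :=
  rTensor_exact M (f := pullMap r f) (g := pullMap r g) hfg hg

lemma tens_surjective_left {X Y : Type u} [AddCommGroup X] [Module B X] [AddCommGroup Y]
    [Module B Y] (g : X →ₗ[B] Y) (hg : Function.Surjective g) (M : ModuleCat.{u} A) :
    Function.Surjective (tensMapLeft l r g M) :=
  LinearMap.rTensor_surjective M (g := pullMap r g) hg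

lemma tens_preservesFiniteLimits (hr : r.Flat) (X : Type u) [AddCommGroup X] [Module B X]
    [Module.Flat B X] : PreservesFiniteLimits (tensFunctor l r X) := by
  have : Module.Flat A (Pull r X) := flat_pull hr X
  rw [Functor.preservesFiniteLimits_iff_forall_exact_map_and_mono]
  intro S hS
  refine ⟨(ShortComplex.moduleCat_exact_iff _).2 fun y hy => ?_, ?_⟩
  · refine (tens_exact (l := l) (r := r) X S.f S.g (fun x => ⟨fun hx => ?_, ?_⟩)
      hS.moduleCat_surjective_g y).1 hy
    · exact (ShortComplex.moduleCat_exact_iff _).1 hS.exact x hx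
    · rintro ⟨y, rfl⟩
      exact ConcreteCategory.congr_hom S.zero y
  · refine (ModuleCat.mono_iff_injective _).2 ?_
    exact Module.Flat.lTensor_preserves_injective_linearMap (M := Pull r X) S.f.hom
      hS.moduleCat_injective_f

end Tensor
/-! ### Completed tensor products of non-complete modules -/

section CompletedTensor

variable {A B : Type u} [CommRing A] [CommRing B] {l r : A →+* B} (I : Ideal A)

/-- `l(J) B · Z` lies in `J Z`, where `A` acts on the `B`-module `Z` through `l`. -/
lemma map_smul_mem_smul_top {J : Ideal A} {b : B} (hb : b ∈ J.map l) {Z : Type u} [AddCommGroup Z]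
    [Module B Z] (z : Z) :
    (show Pull l Z from b • z) ∈ (J • ⊤ : Submodule A (Pull l Z)) := by
  induction hb using Submodule.span_induction generalizing z with
  | mem b hb =>
    obtain ⟨a, ha, rfl⟩ := hb
    exact Submodule.smul_mem_smul (r := a) (n := (show Pull l Z from z)) ha trivial
  | zero => rw [zero_smul]; exact zero_mem _
  | add b c _ _ hb hc => rw [add_smul]; exact add_mem (hb z) (hc z)
  | smul c b _ hb => rw [smul_eq_mul, mul_comm, mul_smul]; exact hb (c • z)

/-- Invariance of `I` moves a scalar in `Iⁿ` from the inner factor of `X ⊗_A M` to the left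
`A`-action. -/
lemma tm_smul_mem (hinv : I.map l = I.map r) (X : Type u) [AddCommGroup X] [Module B X]
    {M : ModuleCat.{u} A} (n : ℕ) (x : X) {m : M} (hm : m ∈ (I ^ n • ⊤ : Submodule A M)) :
    tm l r x m ∈ (I ^ n • ⊤ : Submodule A (tens l r X M)) := by
  induction hm using Submodule.smul_induction_on' with
  | smul a ha m _ =>
    rw [← tm_smul]
    have hb : r a ∈ (I ^ n).map l := by
      rw [Ideal.map_pow, hinv, ← Ideal.map_pow]
      exact Ideal.mem_map_of_mem r ha
    exact map_smul_mem_smul_top hb (Z := Pull r X ⊗[A] M) (tm l r x m)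
  | add m _ m' _ hm hm' => rw [tm_add_right]; exact add_mem hm hm'

/-- `η` induces an injection `X ⊗_A M / Iⁿ → X ⊗_A L₀ M / Iⁿ`: it is split by the map induced by
`L₀ M ⟶ M / Iⁿ M`. -/
lemma adic_map_tensMap_eta_injective (hinv : I.map l = I.map r) (X : Type u) [AddCommGroup X]
    [Module B X] (M : ModuleCat.{u} A) :
    Function.Injective ((adic I).map (tensMap l r X ((eta I).app M))) := by
  have key (n : ℕ) : ∃ ρ : tens l r X ((L0 I).obj M) ⟶
      ModuleCat.of A (tens l r X M ⧸ (I ^ n • ⊤ : Submodule A (tens l r X M))),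
      ∀ z, ρ (tensMap l r X ((eta I).app M) z) = Submodule.Quotient.mk z := by
    -- `q x` sends the class of `m` to the class of `x ⊗ m`
    let S : Submodule A (tens l r X M) := I ^ n • ⊤
    let q : X → (M ⧸ (I ^ n • ⊤ : Submodule A M)) →+ (tens l r X M ⧸ S) := fun x =>
      QuotientAddGroup.lift _ (AddMonoidHom.mk' (fun m => S.mkQ (tm l r x m))
        (fun m m' => by rw [tm_add_right, map_add]))
        (fun m hm => (Submodule.Quotient.mk_eq_zero _).2 (tm_smul_mem I hinv X n x hm))
    have hq (x : X) (m : M) : q x (Submodule.Quotient.mk m) = S.mkQ (tm l r x m) := rfl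
    let p : (L0 I).obj M →ₗ[A] M ⧸ (I ^ n • ⊤ : Submodule A M) :=
      AdicCompletion.eval I M n ∘ₗ ((theta I).app M).hom
    let φ : X →+ (L0 I).obj M →+ (tens l r X M ⧸ S) :=
      AddMonoidHom.mk' (fun x => (q x).comp p.toAddMonoidHom) fun x y => by
        ext w
        change q (x + y) (p w) = q x (p w) + q y (p w)
        obtain ⟨m, hm⟩ := Submodule.Quotient.mk_surjective _ (p w)
        rw [← hm, hq, hq, hq, tm_add_left, map_add]
    have hr (a : A) (x : X) (w : (L0 I).obj M) : φ (r a • x) w = φ x (a • w) := by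
      change q (r a • x) (p w) = q x (p (a • w))
      obtain ⟨m, hm⟩ := Submodule.Quotient.mk_surjective _ (p w)
      rw [map_smul, ← hm, ← Submodule.Quotient.mk_smul, hq, hq, tm_smul]
    have hl (a : A) (x : X) (w : (L0 I).obj M) : φ (l a • x) w = a • φ x w := by
      change q (l a • x) (p w) = a • q x (p w)
      obtain ⟨m, hm⟩ := Submodule.Quotient.mk_surjective _ (p w)
      rw [← hm, hq, hq, ← map_smul, smul_tm]
    have hρ : tensMap l r X ((eta I).app M) ≫
        tensLift (Y := ModuleCat.of A (tens l r X M ⧸ S)) φ hr hl = ModuleCat.ofHom S.mkQ := by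
      refine tens_hom_ext fun x m => ?_
      change q x (AdicCompletion.eval I M n ((theta I).app M ((eta I).app M m))) = _
      rw [show (theta I).app M ((eta I).app M m) = AdicCompletion.of I M m from
        ConcreteCategory.congr_hom (eta_theta I M) m]
      rfl
    exact ⟨tensLift φ hr hl, fun z => ConcreteCategory.congr_hom hρ z⟩
  rw [injective_iff_map_eq_zero]
  intro y hy
  obtain ⟨y, rfl⟩ := AdicCompletion.mk_surjective I _ y
  refine AdicCompletion.ext fun n => (Submodule.Quotient.mk_eq_zero _).2 ?_
  have h1 : tensMap l r X ((eta I).app M) (y n) ∈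
      (I ^ n • ⊤ : Submodule A (tens l r X ((L0 I).obj M))) :=
    (Submodule.Quotient.mk_eq_zero _).1 (congrArg (fun z => z.val n) hy)
  obtain ⟨ρ, hρ⟩ := key n
  rw [← Submodule.Quotient.mk_eq_zero, ← hρ]
  have h2 := Submodule.mem_map_of_mem (f := ρ.hom) h1
  rw [Submodule.map_smul''] at h2
  have h3 := Submodule.smul_mono le_rfl le_top h2
  have h4 : (I ^ n • ⊤ : Submodule A (tens l r X M ⧸ (I ^ n • ⊤ : Submodule A (tens l r X M)))) =
      ⊥ := by
    rw [← Submodule.range_mkQ, ← Submodule.map_top, ← Submodule.map_smul'', ← le_bot_iff,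
      Submodule.map_le_iff_le_comap, Submodule.comap_bot, Submodule.ker_mkQ]
  exact (Submodule.mem_bot A).1 (h4 ▸ h3)

/-- `L₀ (X ⊗_A M) ⟶ L₀ (X ⊗_A L₀ M)`, induced by `η`. -/
def boxEta (l r : A →+* B) (X : Type u) [AddCommGroup X] [Module B X] (M : ModuleCat.{u} A) :
    (L0 I).obj (tens l r X M) ⟶ (L0 I).obj (tens l r X ((L0 I).obj M)) :=
  (L0 I).map (tensMap l r X ((eta I).app M))

lemma boxEta_nat (X : Type u) [AddCommGroup X] [Module B X] {M N : ModuleCat.{u} A} (f : M ⟶ N) :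
    (L0 I).map (tensMap l r X f) ≫ boxEta I l r X N =
      boxEta I l r X M ≫ (L0 I).map (tensMap l r X ((L0 I).map f)) := by
  unfold boxEta
  rw [← Functor.map_comp, ← Functor.map_comp]
  refine congrArg (L0 I).map (tens_hom_ext fun x m => ?_)
  exact congrArg (tm l r x) (eta_nat_apply I f m).symm

lemma boxEta_nat_left {X Y : Type u} [AddCommGroup X] [Module B X] [AddCommGroup Y] [Module B Y]
    (f : X →ₗ[B] Y) (M : ModuleCat.{u} A) :
    (L0 I).map (tensMapLeft l r f M) ≫ boxEta I l r Y M =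
      boxEta I l r X M ≫ (L0 I).map (tensMapLeft l r f ((L0 I).obj M)) := by
  unfold boxEta
  rw [← Functor.map_comp, ← Functor.map_comp]
  exact congrArg (L0 I).map (tens_hom_ext fun x m => rfl)

/-- If `X ⊗_A M` is flat, its `L₀` embeds in its `I`-adic completion, which in turn embeds in the
completion of `X ⊗_A L₀ M`. No flatness of `L₀ M` is involved. -/
lemma boxEta_injective_of_flat (hinv : I.map l = I.map r) (X : Type u) [AddCommGroup X] [Module B X]
    (M : ModuleCat.{u} A) [Module.Flat A (tens l r X M)] :
    Function.Injective (boxEta I l r X M) := by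
  have h : Function.Injective ((theta I).app _ ≫ (adic I).map (tensMap l r X ((eta I).app M))) :=
    (adic_map_tensMap_eta_injective I hinv X M).comp (theta_injective_of_flat I (tens l r X M))
  rw [← NatTrans.naturality] at h
  exact Function.Injective.of_comp (f := (theta I).app _) h

lemma L0_map_exact {M N K : ModuleCat.{u} A} (f : M ⟶ N) (g : N ⟶ K)
    (hfg : Function.Exact f g) (hg : Function.Surjective g) :
    Function.Exact ((L0 I).map f) ((L0 I).map g) := by
  have := (ModuleCat.epi_iff_surjective g).2 hg
  have w : f ≫ g = 0 := by ext x; exact hfg.apply_apply_eq_zero x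
  refine fun x => ⟨fun hx => L0_exact I f g w ?_ x hx, ?_⟩
  · exact (ShortComplex.moduleCat_exact_iff _).2 fun y hy => (hfg y).1 hy
  · rintro ⟨y, rfl⟩
    have : (L0 I).map f ≫ (L0 I).map g = 0 := by
      rw [← Functor.map_comp, w, leftDerived_map_zero]
    exact ConcreteCategory.congr_hom this y

/-- A four lemma: for a map of right exact sequences that is surjective on the left terms and
injective on the middle terms, the map of the right terms is injective. -/
lemma injective_of_exact {K P N P' N' : ModuleCat.{u} A} {K' : ModuleCat.{u} A}
    {i : K ⟶ P} {p : P ⟶ N} {i' : K' ⟶ P'} {p' : P' ⟶ N'} {a : K ⟶ K'} {b : P ⟶ P'} {c : N ⟶ N'}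
    (hi : i ≫ b = a ≫ i') (hp : p ≫ c = b ≫ p') (h0 : i ≫ p = 0) (hex : Function.Exact i' p')
    (hps : Function.Surjective p) (ha : Function.Surjective a) (hb : Function.Injective b) :
    Function.Injective c := by
  rw [injective_iff_map_eq_zero]
  intro z hz
  obtain ⟨z, rfl⟩ := hps z
  obtain ⟨w, hw⟩ := (hex (b z)).1 ((ConcreteCategory.congr_hom hp z).symm.trans hz)
  obtain ⟨w, rfl⟩ := ha w
  have : i w = z := hb ((ConcreteCategory.congr_hom hi w).trans hw)
  rw [← this]
  exact ConcreteCategory.congr_hom h0 w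

variable [IsNoetherianRing A]

/-- `X ⊗_A coker η` is `I`-divisible because `coker η` is and `I` is invariant, so that `L₀`
annihilates it. -/
lemma boxEta_surjective (hinv : I.map l = I.map r) (X : Type u) [AddCommGroup X] [Module B X]
    (M : ModuleCat.{u} A) : Function.Surjective (boxEta I l r X M) := by
  let c := cokernel.π ((eta I).app M)
  have hc : Function.Surjective c := (ModuleCat.epi_iff_surjective c).1 inferInstance
  have hex : Function.Exact ((eta I).app M) c := fun x =>
    ⟨fun hx => (ShortComplex.moduleCat_exact_iff _).1 (ShortComplex.exact_cokernel _) x hx,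
      by rintro ⟨y, rfl⟩; exact ConcreteCategory.congr_hom (cokernel.condition _) y⟩
  have hdiv : (I • ⊤ : Submodule A (tens l r X (cokernel ((eta I).app M)))) = ⊤ := by
    rw [eq_top_iff]
    rintro t -
    induction t using TensorProduct.induction_on with
    | zero => exact zero_mem _
    | tmul x m =>
      have hm : m ∈ (I ^ 1 • ⊤ : Submodule A (cokernel ((eta I).app M) : ModuleCat.{u} A)) := by
        rw [pow_one, coker_eta]
        trivial
      have := tm_smul_mem I hinv X 1 (show X from x) hm
      rwa [pow_one] at this
    | add s t hs ht => exact add_mem hs ht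
  intro y
  exact (L0_map_exact I _ _ (tens_exact X _ c hex hc) (tens_surjective X c hc) y).1
    (L0_eq_zero I hdiv _)

/-- A projective cover of `M` reduces the claim to projective `M`, where `X ⊗_A M` is flat for the
left `A`-action. -/
lemma boxEta_injective_of_projective (hl : l.Flat) (hinv : I.map l = I.map r) (X : Type u)
    [AddCommGroup X] [Module B X] [Module.Projective B X] (M : ModuleCat.{u} A) :
    Function.Injective (boxEta I l r X M) := by
  let p := Projective.π M
  have hp : Function.Surjective p := (ModuleCat.epi_iff_surjective p).1 inferInstance
  have hproj : Module.Projective A (Projective.over M : ModuleCat.{u} A) :=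
    (IsProjective.iff_projective _).2 (Projective.projective_over M)
  have hflat := flat_tens (r := r) hl X (Projective.over M)
  let i : ModuleCat.of A (LinearMap.ker p.hom) ⟶ Projective.over M :=
    ModuleCat.ofHom (LinearMap.ker p.hom).subtype
  have hi : Function.Exact i p := LinearMap.exact_subtype_ker_map p.hom
  have hp' : Function.Surjective ((L0 I).map p) := L0_surj I p
  refine injective_of_exact (boxEta_nat I X i) (boxEta_nat I X p) ?_
    (L0_map_exact I _ _ (tens_exact X _ _ (L0_map_exact I i p hi hp) hp')
      (tens_surjective X _ hp')) ?_
    (boxEta_surjective I hinv X _) (boxEta_injective_of_flat I hinv X (Projective.over M))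
  · ext z
    exact (L0_map_exact I _ _ (tens_exact X i p hi hp) (tens_surjective X p hp)).apply_apply_eq_zero z
  · have := (ModuleCat.epi_iff_surjective (tensMap l r X p)).2 (tens_surjective X p hp)
    exact L0_surj I _

lemma boxEta_injective_of_surjective (hinv : I.map l = I.map r) {F X : Type u} [AddCommGroup F]
    [Module B F] [AddCommGroup X] [Module B X] (g : F →ₗ[B] X) (hg : Function.Surjective g)
    (M : ModuleCat.{u} A) (hF : Function.Injective (boxEta I l r F M)) :
    Function.Injective (boxEta I l r X M) := by
  let f : LinearMap.ker g →ₗ[B] F := (LinearMap.ker g).subtype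
  have hf : Function.Exact f g := LinearMap.exact_subtype_ker_map g
  refine injective_of_exact (boxEta_nat_left I f M) (boxEta_nat_left I g M) ?_
    (L0_map_exact I _ _ (tens_exact_left f g hf hg _) (tens_surjective_left g hg _)) ?_
    (boxEta_surjective I hinv _ M) hF
  · ext z
    exact (L0_map_exact I _ _ (tens_exact_left f g hf hg M)
      (tens_surjective_left g hg M)).apply_apply_eq_zero z
  · have := (ModuleCat.epi_iff_surjective (tensMapLeft l r g M)).2 (tens_surjective_left g hg M)
    exact L0_surj I _

/-- For an invariant ideal, `X ⊠ M` depends only on the `L`-completion of `M`. Both sides are right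
exact in `M` and in `X`, which reduces injectivity to a free module `X` and a projective module
`M`. -/
theorem boxEta_bijective (hl : l.Flat) (hinv : I.map l = I.map r) (X : Type u)
    [AddCommGroup X] [Module B X] (M : ModuleCat.{u} A) :
    Function.Bijective (boxEta I l r X M) :=
  ⟨boxEta_injective_of_surjective I hinv (F := X →₀ B) (Finsupp.linearCombination B id)
    (Finsupp.linearCombination_id_surjective B X) M
    (boxEta_injective_of_projective I hl hinv _ M), boxEta_surjective I hinv X M⟩

end CompletedTensor
/-! ### The right adjoint of completion on comodules -/

section Adjunctions

variable {A Ψ : Type u} [CommRing A] [CommRing Ψ]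

/-- `L₀` as a functor to `L`-complete modules. -/
def L0LMod [IsNoetherianRing A] (I : Ideal A) : ModuleCat.{u} A ⥤ LMod I :=
  (IsLComplete I).lift (L0 I) (isLComplete_L0 I)

/-- `L₀` is left adjoint to the inclusion of `L`-complete modules. -/
def L0Adj [IsNoetherianRing A] (I : Ideal A) : L0LMod I ⊣ (IsLComplete I).ι :=
  Adjunction.mkOfHomEquiv
    { homEquiv := fun M N =>
        { toFun := fun f => (eta I).app M ≫ f.hom
          invFun := fun f => ObjectProperty.homMk (extend I N.property f)
          left_inv := fun f => ObjectProperty.hom_ext _ (L0_hom_ext I N.property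
            (eta_extend I N.property _))
          right_inv := fun f => eta_extend I N.property f }
      homEquiv_naturality_left_symm := fun {M' M N} f g => ObjectProperty.hom_ext _ (by
        refine L0_hom_ext I N.property ?_
        change (eta I).app M' ≫ extend I N.property (f ≫ g) =
          (eta I).app M' ≫ (L0 I).map f ≫ extend I N.property g
        rw [eta_extend, ← Category.assoc, eta_nat, Category.assoc, eta_extend])
      homEquiv_naturality_right := fun {X N N'} f g =>
        (Category.assoc ((eta I).app X) f.hom g.hom).symm }

namespace HopfAlgebroid

variable (H : HopfAlgebroid A Ψ) (I : Ideal A)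

/-- The antipode exchanges the two units, so that the right unit is flat if the left unit is. -/
lemma etaR_flat (hflat : H.etaL.Flat) : H.etaR.Flat := by
  rw [← H.antipode_etaL]
  refine hflat.comp (RingHom.Flat.of_bijective ?_)
  have h (x) : H.antipode (H.antipode x) = x := RingHom.congr_fun H.antipode_antipode x
  exact Function.Involutive.bijective h

lemma hasCoreflexiveEqualizers_comod (hflat : H.etaL.Flat) : HasCoreflexiveEqualizers H.Comod := by
  have : PreservesFiniteLimits (H.Gamma : ModuleCat.{u} A ⥤ ModuleCat.{u} A) :=
    tens_preservesFiniteLimits (H.etaR_flat hflat) Ψ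
  have : HasLimitsOfShape WalkingParallelPair H.Comod :=
    ⟨fun D => Comonad.forget_creates_limits_of_comonad_preserves D⟩
  have : HasEqualizers H.Comod := this
  infer_instance

variable [IsNoetherianRing A]

/-- `L₀` commutes with forgetting coactions. -/
def forgetL0Iso : H.L0Comod I ⋙ (H.GammaHat I).forget ≅ H.Gamma.forget ⋙ L0LMod I :=
  Iso.refl _

/-- The comonadic adjoint lifting theorem applies to the square of forgetful functors, because
flatness of `Ψ` gives equalizers of comodules. -/
lemma L0Comod_isLeftAdjoint (hflat : H.etaL.Flat) : (H.L0Comod I).IsLeftAdjoint := by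
  have := H.hasCoreflexiveEqualizers_comod hflat
  have : (L0LMod I).IsLeftAdjoint := (L0Adj I).isLeftAdjoint
  have : H.Gamma.forget.IsLeftAdjoint := H.Gamma.adj.isLeftAdjoint
  exact isLeftAdjoint_square_lift_comonadic (H.L0Comod I) (H.GammaHat I).forget H.Gamma.forget
    (L0LMod I) (H.forgetL0Iso I).symm

/-- Both functors are right adjoint to `M ↦ L₀ M`, from comodules to `L`-complete modules. -/
def cofreeIso {ι : H.ComodHat I ⥤ H.Comod} (adj : H.L0Comod I ⊣ ι) :
    (H.GammaHat I).cofree ⋙ ι ≅ (IsLComplete I).ι ⋙ H.Gamma.cofree :=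
  ((adj.comp (H.GammaHat I).adj).ofNatIsoLeft (H.forgetL0Iso I)).rightAdjointUniq
    (H.Gamma.adj.comp (L0Adj I))

/-- The extended comodule `Ψ̂ ⊠ N` agrees with the cofree comodule on the `L`-complete module
`L₀ N`; the isomorphism is `1 ⊠ η`. -/
def extendedHatIso (hflat : H.etaL.Flat) (hinv : I.map H.etaL = I.map H.etaR) :
    H.extendedHat I ≅ L0LMod I ⋙ (H.GammaHat I).cofree := by
  have h (N : ModuleCat.{u} A) : IsIso (boxEta I H.etaL H.etaR (H.PsiHat I) N) :=
    (ConcreteCategory.isIso_iff_bijective _).2 (boxEta_bijective I hflat hinv (H.PsiHat I) N)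
  refine NatIso.ofComponents (fun N => Comonad.Coalgebra.isoMk
    ((IsLComplete I).isoMk (@asIso _ _ _ _ (boxEta I H.etaL H.etaR (H.PsiHat I) N) (h N))) ?_) ?_
  · exact ObjectProperty.hom_ext _ (H.deltaHat_nat I ((eta I).app N)).symm
  · intro N K f
    refine Comonad.Coalgebra.Hom.ext (ObjectProperty.hom_ext _ ?_)
    exact boxEta_nat I (H.PsiHat I) f

end HopfAlgebroid
end Adjunctions
end
end LComp

theorem mainTheorem8 {A Ψ : Type u} [CommRing A] [IsRegularLocalRing A] [CommRing Ψ]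
    (H : LComp.HopfAlgebroid A Ψ) (hflat : H.etaL.Flat)
    (hinv : (IsLocalRing.maximalIdeal A).map H.etaL = (IsLocalRing.maximalIdeal A).map H.etaR) :
    (H.L0Comod (IsLocalRing.maximalIdeal A)).IsLeftAdjoint ∧
    ∀ (ι : H.ComodHat (IsLocalRing.maximalIdeal A) ⥤ H.Comod)
      (_ : H.L0Comod (IsLocalRing.maximalIdeal A) ⊣ ι),
      (∀ N : ModuleCat.{u} A,
        Nonempty (ι.obj ((H.extendedHat (IsLocalRing.maximalIdeal A)).obj N) ≅
          H.Gamma.cofree.obj ((LComp.L0 (IsLocalRing.maximalIdeal A)).obj N))) ∧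
      Nonempty (H.extendedHat (IsLocalRing.maximalIdeal A) ⋙ ι ≅
        LComp.L0 (IsLocalRing.maximalIdeal A) ⋙ H.Gamma.cofree) ∧
      Nonempty ((H.GammaHat (IsLocalRing.maximalIdeal A)).cofree ⋙ ι ≅
        (LComp.IsLComplete (IsLocalRing.maximalIdeal A)).ι ⋙ H.Gamma.cofree) := by
  refine ⟨H.L0Comod_isLeftAdjoint _ hflat, fun ι adj => ?_⟩
  let e := H.cofreeIso _ adj
  let e' : H.extendedHat (IsLocalRing.maximalIdeal A) ⋙ ι ≅
      LComp.L0 (IsLocalRing.maximalIdeal A) ⋙ H.Gamma.cofree :=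
    Functor.isoWhiskerRight (H.extendedHatIso _ hflat hinv) ι ≪≫
      Functor.isoWhiskerLeft (LComp.L0LMod _) e
  exact ⟨fun N => ⟨e'.app N⟩, ⟨e'⟩, ⟨e⟩⟩
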